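/- **Setting.** Let $(M,d)$ be a proper metric space and $\mathfrak m$ a Radon measure on $M$ with full support. Let $\le$ be a preorder on $M$, $\ll$ a transitive relation contained in $\le$, and $\tau\colon M^2\to[0,\infty]$ a lower semicontinuous function with $\tau(x,y)=0$ if $x\not\le y$, $\tau(x,y)>0$ iff $x\ll y$, and $\tau(x,z)\ge\tau(x,y)+\tau(y,z)$ if $x\le y\le z$ (such data form a *Lorentzian pre-length space*). A continuous curve $\gamma\colon[0,1]\to M$ of constant $d$-speed is *causal* (*timelike*) if $\gamma_s\le\gamma_t$ ($\gamma_s\ll\gamma_t$) for all $s<t$. Set $\mathrm{Len}_\tau(\gamma)=\inf\sum_i\tau(\gamma_{t_{i}},\gamma_{t_{i+1}})$, the infimum over partitions $0=t_0<\dots<t_n=1$. A *geodesic* is a causal curve with $\mathrm{Len}_\tau(\gamma)=\tau(\gamma_0,\gamma_1)$; $\mathrm{TGeo}(M)$ is the set of timelike geodesics. Assume that the space is - *locally causally closed*: every point has an open neighbourhood $U$ such that $\{(x,y)\in\bar U^2: x\le y\}$ is closed; - *globally hyperbolic*: for every compact $C$ the $d$-lengths of causal curves in $C$ are uniformly bounded,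 and $J(x,y)=\{z:x\le z\le y\}$ is compact for all $x,y\in M$; - *geodesic*: it is localizable, and any $x\le y$ with $x\ne y$ are joined by a geodesic. *Localizable* means that every point has an open neighbourhood $\Omega$ such that the $d$-lengths of causal curves in $\Omega$ are uniformly bounded; there is a continuous $\omega\colon\Omega^2\to[0,\infty)$ making $\Omega$ (with the restricted $d,\ll,\le$) a Lorentzian pre-length space; for each $y\in\Omega$ there are $z,z'\in\Omega$ with $z\ll y\ll z'$; and any $y\le z$ in $\Omega$ with $y\neq z$ are joined by a causal curve $\gamma$ in $\Omega$ which has maximal $\tau$-length among the causal curves in $\Omega$ from $y$ to $z$ and satisfies $\mathrm{Len}_\tau(\gamma)=\omega(y,z)\le\tau(y,z)$. (These assumptions hold in particular for causally closed, regular Lorentzian geodesic spaces that are $\mathscr K$-globally hyperbolic, i.e. the length bound above holds and $\{z:x\le z\le y\text{ for some }x\in C_0,\,y\in C_1\}$ is compact for all compact $C_0,C_1$.) **Optimal transport.** Let $p\in(0,1)$. A coupling $\pi$ of Borel probability measures $\mu,\nu$ on $M$ is *causal* (*chronological*) if $x\le y$ ($x\ll y$) for $\pi$-a.e. $(x,y)$.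 Put $\ell_p(\mu,\nu)=\sup\|\tau\|_{L^p(\pi)}$ over causal couplings $\pi$ ($\sup\emptyset=-\infty$); $\ell_p$-*optimal* couplings are causal couplings attaining it. Let $l^p(x,y)=\tau(x,y)^p$ if $x\le y$ and $-\infty$ otherwise. The pair $(\mu,\nu)$ is *timelike $p$-dualizable* by $\pi$ if $\pi$ is a chronological $\ell_p$-optimal coupling and there are Borel functions $a,b\colon M\to\mathbb R$ with $a\oplus b\in L^1(\mu\otimes\nu)$, where $(a\oplus b)(x,y)=a(x)+b(y)$, and $l^p\le a\oplus b$ on $\operatorname{supp}\mu\times\operatorname{supp}\nu$. It is *strongly* timelike $p$-dualizable if moreover there is an $l^p$-cyclically monotone Borel set $\Gamma\subset\{x\ll y\}\cap(\operatorname{supp}\mu\times\operatorname{supp}\nu)$ such that a causal coupling $\sigma$ of $\mu,\nu$ is $\ell_p$-optimal iff $\sigma[\Gamma]=1$. (A set $\Gamma$ is $l^p$-cyclically monotone if $\sum_{i=1}^n l^p(x_{i+1},y_i)\le\sum_{i=1}^n l^p(x_i,y_i)$ for all $(x_1,y_1),\dots,(x_n,y_n)\in\Gamma$, with $x_{n+1}:=x_1$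 and the convention $\infty-\infty:=-\infty$.) For $\eta\in\mathrm{TGeo}(M)$ let $\mathsf r(\eta)=\eta\circ\psi_\eta^{-1}$ with $\psi_\eta(t)=\tau(\eta_0,\eta_t)/\tau(\eta_0,\eta_1)$. A *timelike proper-time parametrized $\ell_p$-geodesic* is a weakly continuous path $(\mu_t)_{t\in[0,1]}$ of Borel probability measures on $M$ such that $\mu_t$ is, for every $t$, the law of $\mathsf r(\eta)_t$ under one fixed probability measure $\boldsymbol\alpha$ concentrated on $\mathrm{TGeo}(M)$ for which the law of $(\eta_0,\eta_1)$ is an $\ell_p$-optimal coupling of $\mu_0,\mu_1$. **Curvature-dimension condition.** For $\kappa\in\mathbb R$, $t\in[0,1]$, $\vartheta\ge0$ set $\sigma_\kappa^{(t)}(\vartheta)=\infty$ if $\kappa\vartheta^2\ge\pi^2$, $\sigma_\kappa^{(t)}(\vartheta)=t$ if $\kappa\vartheta^2=0$, and $\sigma_\kappa^{(t)}(\vartheta)=\mathfrak s_\kappa(t\vartheta)/\mathfrak s_\kappa(\vartheta)$ otherwise, where $\mathfrak s_\kappa(\vartheta)=\sin(\sqrt\kappa\,\vartheta)/\sqrt\kappa$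 for $\kappa>0$ and $\mathfrak s_\kappa(\vartheta)=\sinh(\sqrt{-\kappa}\,\vartheta)/\sqrt{-\kappa}$ for $\kappa<0$; and $\tau_{K,N}^{(t)}(\vartheta)=t^{1/N}\sigma_{K/(N-1)}^{(t)}(\vartheta)^{1-1/N}$ (with $0\cdot\infty=0$; for $N=1$ the second factor is read as $\infty$ if $K\vartheta^2>0$ and as $1$ otherwise). For $\mu=\rho\,\mathfrak m+\mu_\perp$ (Lebesgue decomposition) let $\mathscr S_N(\mu)=-\int_{\{\rho>0\}}\rho^{1-1/N}\,d\mathfrak m$. The condition $\mathrm{wTCD}_p(K,N)$ means: for every strongly timelike $p$-dualizable pair $(\mu_0,\mu_1)=(\rho_0\mathfrak m,\rho_1\mathfrak m)$ of compactly supported, $\mathfrak m$-absolutely continuous probability measures there are a timelike proper-time parametrized $\ell_p$-geodesic $(\mu_t)_{t\in[0,1]}$ from $\mu_0$ to $\mu_1$ and a coupling $\pi$ by which $(\mu_0,\mu_1)$ is timelike $p$-dualizable, such that for all $t\in[0,1]$ and all $N'\ge N$ $$\mathscr S_{N'}(\mu_t)\le-\int_{M^2}\tau_{K,N'}^{(1-t)}(\tau(x^0,x^1))\,\rho_0(x^0)^{-1/N'}\,d\pi(x^0,x^1)-\int_{M^2}\tau_{K,N'}^{(t)}(\tau(x^0,x^1))\,\rho_1(x^1)^{-1/N'}\,d\pi(x^0,x^1).$$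 **Corollary 3.10 (sharp timelike Bonnet–Myers inequality).** If $\mathrm{wTCD}_p(K,N)$ holds for some $p\in(0,1)$, $K>0$ and $N\in[1,\infty)$, then $$\sup\tau(M^2)\le\pi\sqrt{\frac{N-1}{K}}.$$ -/

import Mathlib

open MeasureTheory Set
open scoped ENNReal NNReal unitInterval

noncomputable section

namespace TimelikeCD

/-! ### Lorentzian pre-length spaces -/

/-- A Lorentzian pre-length space over the metric space `X`: a preorder `causal` (written `≤` on
paper), a transitive relation `chron` (written `≪`) contained in it, and a time separation
function `tau`. -/
structure LorentzianPreLengthSpace (X : Type*) [MetricSpace X] where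
  chron : X → X → Prop
  causal : X → X → Prop
  tau : X → X → ℝ≥0∞
  causal_refl : ∀ x, causal x x
  causal_trans : ∀ x y z, causal x y → causal y z → causal x z
  chron_trans : ∀ x y z, chron x y → chron y z → chron x z
  causal_of_chron : ∀ x y, chron x y → causal x y
  lowerSemicontinuous_tau : LowerSemicontinuous (fun q : X × X => tau q.1 q.2)
  tau_eq_zero : ∀ x y, ¬ causal x y → tau x y = 0
  tau_pos_iff : ∀ x y, 0 < tau x y ↔ chron x y
  reverse_triangle : ∀ x y z, causal x y → causal y z → tau x y + tau y z ≤ tau x z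

namespace LorentzianPreLengthSpace

variable {M : Type*} [MetricSpace M] (L : LorentzianPreLengthSpace M)

/-- Every point has an open neighbourhood `U` such that `≤` restricted to `closure U` is
closed. (Relatively closed in `closure U × closure U` is the same as closed.) -/
def LocallyCausallyClosed : Prop :=
  ∀ x : M, ∃ U : Set M, IsOpen U ∧ x ∈ U ∧
    IsClosed {q : M × M | q.1 ∈ closure U ∧ q.2 ∈ closure U ∧ L.causal q.1 q.2}

/-- The causal diamond `J(x, y)`. -/
def causalDiamond (x y : M) : Set M := {z | L.causal x z ∧ L.causal z y}

/-! ### Curves -/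

/-- The length of a curve on `[0,1]` with respect to the background metric. -/
def metricLength (γ : C(I, M)) : ℝ≥0∞ := eVariationOn γ univ

/-- The curve has constant (finite) metric speed; in particular it is Lipschitz. -/
def HasConstantSpeed (γ : C(I, M)) : Prop :=
  ∃ c : ℝ≥0, ∀ s t : I, s ≤ t → eVariationOn γ (Icc s t) = ENNReal.ofReal (c * ((t : ℝ) - s))

/-- Future-directed causal curves on `[0,1]`. -/
def IsCausalCurve (γ : C(I, M)) : Prop :=
  HasConstantSpeed γ ∧ ∀ s t : I, s < t → L.causal (γ s) (γ t)

/-- Future-directed timelike curves on `[0,1]`. -/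
def IsTimelikeCurve (γ : C(I, M)) : Prop :=
  HasConstantSpeed γ ∧ ∀ s t : I, s < t → L.chron (γ s) (γ t)

/-- The length with respect to `tau`: the infimum over all partitions
`0 = t 0 < t 1 < ... < t n = 1` of the sum of the `tau (γ (t i)) (γ (t (i + 1)))`. -/
def tauLength (γ : C(I, M)) : ℝ≥0∞ :=
  ⨅ (n : ℕ) (t : Fin (n + 1) → I) (_ : StrictMono t) (_ : t 0 = 0) (_ : t (Fin.last n) = 1),
    ∑ i : Fin n, L.tau (γ (t i.castSucc)) (γ (t i.succ))

/-- Geodesics (maximal causal curves). -/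
def Geo : Set C(I, M) :=
  {γ | L.IsCausalCurve γ ∧ L.tauLength γ = L.tau (γ 0) (γ 1)}

/-- Timelike geodesics. -/
def TGeo : Set C(I, M) := {γ | γ ∈ L.Geo ∧ L.IsTimelikeCurve γ}

/-! ### Global assumptions on the space -/

/-- In every compact set, the metric length of causal curves is uniformly bounded. -/
def NonTotallyImprisoning : Prop :=
  ∀ C : Set M, IsCompact C → ∃ c : ℝ≥0, ∀ γ : C(I, M),
    L.IsCausalCurve γ → (∀ t, γ t ∈ C) → metricLength γ ≤ c

def GloballyHyperbolic : Prop :=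
  L.NonTotallyImprisoning ∧ ∀ x y : M, IsCompact (L.causalDiamond x y)

/-- `γ` is a causal curve inside `Ω` which is maximal in `Ω`: no causal curve inside `Ω` with the
same endpoints has larger `tau`-length. -/
def IsMaximalIn (Ω : Set M) (γ : C(I, M)) : Prop :=
  L.IsCausalCurve γ ∧ (∀ t, γ t ∈ Ω) ∧
    ∀ γ' : C(I, M), L.IsCausalCurve γ' → (∀ t, γ' t ∈ Ω) → γ' 0 = γ 0 → γ' 1 = γ 1 →
      L.tauLength γ' ≤ L.tauLength γ

/-- Every point has an open neighbourhood `Ω` such that: causal curves in `Ω` have uniformly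
bounded metric length; `Ω` with the restricted relations carries a finite, continuous time
separation function `ω`, and every point of `Ω` has a chronological predecessor and a
chronological successor in `Ω`; and any `y < z` in `Ω` are joined by a causal curve maximal
in `Ω`, of `tau`-length `ω y z ≤ tau y z`. -/
def Localizable : Prop :=
  ∀ x : M, ∃ Ω : Set M, IsOpen Ω ∧ x ∈ Ω ∧
    (∃ c : ℝ≥0, ∀ γ : C(I, M), L.IsCausalCurve γ → (∀ t, γ t ∈ Ω) → metricLength γ ≤ c) ∧
    ∃ W : LorentzianPreLengthSpace Ω,
      (∀ y z : Ω, W.chron y z ↔ L.chron y z) ∧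
      (∀ y z : Ω, W.causal y z ↔ L.causal y z) ∧
      (∀ y z : Ω, W.tau y z ≠ ∞) ∧
      Continuous (fun q : Ω × Ω => W.tau q.1 q.2) ∧
      (∀ y : Ω, (∃ z : Ω, L.chron y z) ∧ ∃ z : Ω, L.chron z y) ∧
      ∀ y z : Ω, L.causal y z → y ≠ z →
        ∃ γ : C(I, M), L.IsMaximalIn Ω γ ∧ γ 0 = y ∧ γ 1 = z ∧
          L.tauLength γ = W.tau y z ∧ W.tau y z ≤ L.tau y z

/-- Lorentzian geodesic spaces: localizable, and `x < y` implies that `x` and `y` are joined by a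
geodesic. -/
def IsGeodesicSpace : Prop :=
  L.Localizable ∧
    ∀ x y : M, L.causal x y → x ≠ y → ∃ η ∈ L.Geo, η 0 = x ∧ η 1 = y

/-! ### Proper-time reparametrization -/

/-- `γ` is the proper-time reparametrization of `η`: `γ ∘ ψ = η` for
`ψ s = tau (η 0) (η s) / tau (η 0) (η 1)`. -/
def IsProperTimeReparam (η γ : C(I, M)) : Prop :=
  ∀ s t : I, (t : ℝ) = (L.tau (η 0) (η s)).toReal / (L.tau (η 0) (η 1)).toReal → γ t = η s

open Classical in
/-- The reparametrization map `r`. When `ψ` is a bijection of `[0,1]`, as is the case for timelike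
geodesics in the spaces considered below, `γ = η ∘ ψ⁻¹` is the only curve with
`IsProperTimeReparam η γ`. The value at curves that have no reparametrization is irrelevant. -/
def reparam (η : C(I, M)) : C(I, M) :=
  if h : ∃ γ : C(I, M), L.IsProperTimeReparam η γ then h.choose else η

end LorentzianPreLengthSpace

/-! ### Optimal transport -/

/-- The space of curves `[0,1] → M` with the topology of uniform convergence carries its Borel
sigma-algebra. -/
instance instMeasurableSpaceCurves {M : Type*} [TopologicalSpace M] :
    MeasurableSpace C(I, M) := borel _

instance instBorelSpaceCurves {M : Type*} [TopologicalSpace M] : BorelSpace C(I, M) := ⟨rfl⟩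

namespace LorentzianPreLengthSpace

variable {M : Type*} [MetricSpace M] [MeasurableSpace M] [BorelSpace M]
  (L : LorentzianPreLengthSpace M)

/-- Couplings `Π(μ, ν)`. -/
def Couplings (μ ν : ProbabilityMeasure M) : Set (Measure (M × M)) :=
  {π | π.fst = (μ : Measure M) ∧ π.snd = (ν : Measure M)}

/-- Causal couplings. -/
def CausalCouplings (μ ν : ProbabilityMeasure M) : Set (Measure (M × M)) :=
  {π | π ∈ Couplings μ ν ∧ ∀ᵐ q ∂π, L.causal q.1 q.2}

/-- Chronological couplings. -/
def ChronCouplings (μ ν : ProbabilityMeasure M) : Set (Measure (M × M)) :=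
  {π | π ∈ Couplings μ ν ∧ ∀ᵐ q ∂π, L.chron q.1 q.2}

/-- The `L^p` norm of `tau` with respect to `π`. -/
def tauNorm (p : ℝ) (π : Measure (M × M)) : ℝ≥0∞ :=
  (∫⁻ q, L.tau q.1 q.2 ^ p ∂π) ^ (1 / p)

/-- The total transport cost `ℓ_p`; the supremum of the empty set is `-∞`. -/
def lorentzWasserstein (p : ℝ) (μ ν : ProbabilityMeasure M) : EReal :=
  ⨆ π ∈ L.CausalCouplings μ ν, ((L.tauNorm p π : ℝ≥0∞) : EReal)

/-- `ℓ_p`-optimal couplings. -/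
def IsOptimal (p : ℝ) (μ ν : ProbabilityMeasure M) (π : Measure (M × M)) : Prop :=
  π ∈ L.CausalCouplings μ ν ∧ L.lorentzWasserstein p μ ν = ((L.tauNorm p π : ℝ≥0∞) : EReal)

open Classical in
/-- The function `l^p`, equal to `tau^p` on causally related pairs and to `-∞` elsewhere. -/
def costPow (p : ℝ) (x y : M) : EReal :=
  if L.causal x y then ((L.tau x y ^ p : ℝ≥0∞) : EReal) else ⊥

/-- `l^p`-cyclically monotone sets; the index `i + 1` is taken cyclically. -/
def IsCyclicallyMonotone (p : ℝ) (Γ : Set (M × M)) : Prop :=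
  ∀ (n : ℕ) (z : Fin (n + 1) → M × M), (∀ i, z i ∈ Γ) →
    ∑ i, L.costPow p (z (i + 1)).1 (z i).2 ≤ ∑ i, L.costPow p (z i).1 (z i).2

/-- `(μ, ν)` is timelike `p`-dualizable by `π`. -/
def TimelikeDualizableBy (p : ℝ) (μ ν : ProbabilityMeasure M) (π : Measure (M × M)) : Prop :=
  π ∈ L.ChronCouplings μ ν ∧ L.IsOptimal p μ ν π ∧
    ∃ a b : M → ℝ, Measurable a ∧ Measurable b ∧
      Integrable (fun q : M × M => a q.1 + b q.2)
        ((μ : Measure M).prod (ν : Measure M)) ∧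
      ∀ x ∈ (μ : Measure M).support, ∀ y ∈ (ν : Measure M).support,
        L.costPow p x y ≤ ((a x + b y : ℝ) : EReal)

/-- `(μ, ν)` is strongly timelike `p`-dualizable. -/
def StronglyTimelikeDualizable (p : ℝ) (μ ν : ProbabilityMeasure M) : Prop :=
  (∃ π, L.TimelikeDualizableBy p μ ν π) ∧
    ∃ Γ : Set (M × M), MeasurableSet Γ ∧
      (∀ q ∈ Γ, L.chron q.1 q.2 ∧ q.1 ∈ (μ : Measure M).support ∧
        q.2 ∈ (ν : Measure M).support) ∧
      L.IsCyclicallyMonotone p Γ ∧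
      ∀ ϖ ∈ L.CausalCouplings μ ν, L.IsOptimal p μ ν ϖ ↔ ϖ Γ = 1

/-- Probability measures on timelike geodesics whose endpoint marginal is an `ℓ_p`-optimal
coupling of `μ` and `ν`. -/
def OptTGeo (p : ℝ) (μ ν : ProbabilityMeasure M) : Set (Measure C(I, M)) :=
  {α | IsProbabilityMeasure α ∧ (∀ᵐ γ ∂α, γ ∈ L.TGeo) ∧
    L.IsOptimal p μ ν (α.map (fun γ => (γ 0, γ 1)))}

/-- The image of `OptTGeo` under push-forward by the reparametrization map. -/
def OptTGeoTau (p : ℝ) (μ ν : ProbabilityMeasure M) : Set (Measure C(I, M)) :=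
  (fun α => α.map L.reparam) '' L.OptTGeo p μ ν

/-- Timelike proper-time parametrized `ℓ_p`-geodesics: weakly continuous paths represented by an
element of `OptTGeoTau`. -/
def IsTimelikeProperTimeGeodesic (p : ℝ) (μ : I → ProbabilityMeasure M) : Prop :=
  Continuous μ ∧ ∃ Λ ∈ L.OptTGeoTau p (μ 0) (μ 1),
    ∀ t : I, (μ t : Measure M) = Λ.map (fun γ => γ t)

end LorentzianPreLengthSpace

/-! ### Distortion coefficients and Rényi entropy -/

/-- The generalized sine `s_κ`. -/
def genSin (κ θ : ℝ) : ℝ :=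
  if 0 < κ then Real.sin (√κ * θ) / √κ
  else if κ = 0 then θ
  else Real.sinh (√(-κ) * θ) / √(-κ)

/-- The coefficient `σ_κ^{(t)}(θ)`. -/
def sigmaCoeff (κ t θ : ℝ) : ℝ≥0∞ :=
  if Real.pi ^ 2 ≤ κ * θ ^ 2 then ∞
  else if κ * θ ^ 2 = 0 then ENNReal.ofReal t
  else ENNReal.ofReal (genSin κ (t * θ) / genSin κ θ)

/-- The coefficient `τ_{K,N}^{(t)}(θ) = t^{1/N} σ_{K/(N-1)}^{(t)}(θ)^{1-1/N}`. For `N = 1` the second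
factor is its limit as `N` decreases to `1`: infinite if `K θ² > 0`, and `1` otherwise. -/
def tauCoeff (K N t θ : ℝ) : ℝ≥0∞ :=
  ENNReal.ofReal t ^ (1 / N) *
    (if N = 1 then (if 0 < K * θ ^ 2 then ∞ else 1)
      else sigmaCoeff (K / (N - 1)) t θ ^ (1 - 1 / N))

/-- The `N`-Rényi entropy `-∫ ρ^{1-1/N} dm` of `μ = ρ m + μ_⊥`. The integral runs over `{ρ > 0}`,
which only matters for `N = 1`. -/
def renyiEntropy {M : Type*} [MeasurableSpace M] (N : ℝ) (m μ : Measure M) : EReal :=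
  -((∫⁻ x in {x | 0 < μ.rnDeriv m x}, μ.rnDeriv m x ^ (1 - 1 / N) ∂m : ℝ≥0∞) : EReal)

/-! ### The weak timelike curvature-dimension condition -/

/-- Compactly supported, `m`-absolutely continuous probability measures. -/
def PcAC {M : Type*} [MetricSpace M] [MeasurableSpace M] [BorelSpace M] (m : Measure M) :
    Set (ProbabilityMeasure M) :=
  {μ | IsCompact (μ : Measure M).support ∧ (μ : Measure M) ≪ m}

/-- The condition `wTCD_p(K,N)`. The time separation `tau` is finite on `supp μ₀ × supp μ₁` for
every timelike `p`-dualizable pair, so that `toReal` loses nothing. -/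
def WTCD {M : Type*} [MetricSpace M] [MeasurableSpace M] [BorelSpace M]
    (L : LorentzianPreLengthSpace M) (m : Measure M) (p K N : ℝ) : Prop :=
  ∀ μ₀ ∈ PcAC m, ∀ μ₁ ∈ PcAC m, L.StronglyTimelikeDualizable p μ₀ μ₁ →
    ∃ μ : I → ProbabilityMeasure M, L.IsTimelikeProperTimeGeodesic p μ ∧ μ 0 = μ₀ ∧ μ 1 = μ₁ ∧
      ∃ π : Measure (M × M), L.TimelikeDualizableBy p μ₀ μ₁ π ∧
        ∀ (t : I) (N' : ℝ), N ≤ N' →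
          renyiEntropy N' m (μ t) ≤
            -((∫⁻ q, tauCoeff K N' (1 - t) (L.tau q.1 q.2).toReal *
                (μ₀ : Measure M).rnDeriv m q.1 ^ (-1 / N') ∂π : ℝ≥0∞) : EReal)
            - ((∫⁻ q, tauCoeff K N' t (L.tau q.1 q.2).toReal *
                (μ₁ : Measure M).rnDeriv m q.2 ^ (-1 / N') ∂π : ℝ≥0∞) : EReal)

end TimelikeCD

end

/-! Suppose `tau x y` exceeds D = π√((N-1)/K). If `tau` is finite and continuous, then `tau` > D on
a product of small closed balls around `x` and `y`. Take for μ₀ and μ₁ the normalised restrictions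
of `m` to these balls. If this pair is strongly timelike dualizable, `WTCD` supplies intermediate
measures. At t = 1/2 and N' = N the distortion coefficient is infinite at every pair of points in
the supports, so the right-hand side of the entropy inequality is -∞. The left-hand side is not:
choose `a` ≪ x and `b` ≫ y. After shrinking the balls, all transport takes place in the compact
diamond J(a, b), and a probability measure on a set of finite volume has Rényi entropy at least
-(m(J) + 1). This is the contradiction.

Two inputs carry the argument. The first is `continuous_tau`, where only upper semicontinuity has to
be shown. Geodesics between nearby points stay in one compact diamond and are equi-Lipschitz, so a
subsequence converges uniformly. On a subdivision subordinate to localizing neighbourhoods, their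
`tau`-lengths are bounded by sums of the continuous local time separations. These sums converge, and
their limit is at most `tau` of the limit endpoints by the reverse triangle inequality.

The second is `stronglyTimelikeDualizable_of_chron`. For a continuous cost on compact supports,
Kantorovich duality follows from Hahn–Banach and Riesz–Markov–Kakutani. The cyclically monotone set
is where the duality gaps of a fast minimizing sequence of potentials tend to zero, so exact
potentials are not needed. -/

noncomputable section

namespace TimelikeCD.LorentzianPreLengthSpace

open Filter Topology

/-! ### Local time separations. -/

section Local

variable {M : Type*} [MetricSpace M] (L : LorentzianPreLengthSpace M)

/-- An open set `V` with a finite continuous function `w ≤ tau` that bounds the `tau`-length of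
causal curves in `V`, and on which the causal relation is relatively closed. -/
structure IsLocalPiece (V : Set M) (w : M → M → ℝ≥0∞) : Prop where
  isOpen : IsOpen V
  ne_top : ∀ y ∈ V, ∀ z ∈ V, w y z ≠ ∞
  continuousOn : ContinuousOn (fun q : M × M => w q.1 q.2) (V ×ˢ V)
  le_tau : ∀ y ∈ V, ∀ z ∈ V, w y z ≤ L.tau y z
  tauLength_le : ∀ γ : C(I, M), L.IsCausalCurve γ → (∀ t, γ t ∈ V) →
    L.tauLength γ ≤ w (γ 0) (γ 1)
  causal_of_mem_closure : ∀ y ∈ V, ∀ z ∈ V,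
    (y, z) ∈ closure {q : M × M | q.1 ∈ V ∧ q.2 ∈ V ∧ L.causal q.1 q.2} → L.causal y z

variable {L}

/-- The reverse triangle inequality alone allows the value ∞ on the diagonal. The local time
separation is finite, so it must vanish there, and it has the same chronological relation as `tau`.
-/
lemma Localizable.tau_self (h : L.Localizable) (x : M) : L.tau x x = 0 := by
  obtain ⟨Ω, -, hx, -, W, hchron, -, hfin, -⟩ := h x
  have h1 := W.reverse_triangle ⟨x, hx⟩ ⟨x, hx⟩ ⟨x, hx⟩ (W.causal_refl _) (W.causal_refl _)
  have h2 : W.tau ⟨x, hx⟩ ⟨x, hx⟩ = 0 := by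
    by_contra h0
    exact absurd h1 (not_le.2 (ENNReal.lt_add_right (hfin _ _) h0))
  by_contra h0
  have h3 := (L.tau_pos_iff x x).1 (pos_iff_ne_zero.2 h0)
  have h4 := (W.tau_pos_iff _ _).2 ((hchron ⟨x, hx⟩ ⟨x, hx⟩).2 h3)
  exact h4.ne' h2

lemma Localizable.exists_chron (h : L.Localizable) (x : M) :
    (∃ z, L.chron z x) ∧ ∃ z, L.chron x z := by
  obtain ⟨Ω, -, hx, -, W, -, -, -, -, hc, -⟩ := h x
  obtain ⟨⟨z, hz⟩, ⟨z', hz'⟩⟩ := hc ⟨x, hx⟩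
  exact ⟨⟨_, hz'⟩, ⟨_, hz⟩⟩

lemma tauLength_le_tau (γ : C(I, M)) : L.tauLength γ ≤ L.tau (γ 0) (γ 1) := by
  refine (iInf₂_le 1 ![0, 1]).trans ?_
  refine iInf_le_of_le ?_ (iInf_le_of_le ?_ (iInf_le_of_le ?_ ?_))
  · rw [Fin.strictMono_iff_lt_succ]; intro i; fin_cases i; simp
  · rfl
  · rfl
  · simp

/-- The piece is the intersection of a localizing neighbourhood with a causally closed one, and `w`
is the local time separation extended by zero. Maximality of the local maximizers bounds the length
of every causal curve in the piece. Maximizers exist only between distinct points, so coinciding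
endpoints are treated through `tau_self`. -/
lemma Localizable.exists_isLocalPiece (h : L.Localizable) (hc : L.LocallyCausallyClosed)
    (x : M) : ∃ V w, L.IsLocalPiece V w ∧ x ∈ V := by
  classical
  obtain ⟨Ω, hΩ, hx, -, W, hchron, hcausal, hfin, hcont, -, hmax⟩ := h x
  obtain ⟨U, hU, hxU, hUc⟩ := hc x
  let w : M → M → ℝ≥0∞ := fun y z =>
    if h : y ∈ Ω ∧ z ∈ Ω then W.tau ⟨y, h.1⟩ ⟨z, h.2⟩ else 0
  have hw : ∀ y (hy : y ∈ Ω) z (hz : z ∈ Ω), w y z = W.tau ⟨y, hy⟩ ⟨z, hz⟩ :=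
    fun y hy z hz => dif_pos ⟨hy, hz⟩
  refine ⟨Ω ∩ U, w, ⟨hΩ.inter hU, ?_, ?_, ?_, ?_, ?_⟩, hx, hxU⟩
  · intro y hy z hz
    rw [hw y hy.1 z hz.1]; exact hfin _ _
  · refine ContinuousOn.mono (s := Ω ×ˢ Ω) ?_ (prod_mono inter_subset_left inter_subset_left)
    rw [continuousOn_iff_continuous_domRestrict]
    have : (Ω ×ˢ Ω).domRestrict (fun q : M × M => w q.1 q.2) =
        (fun q : Ω × Ω => W.tau q.1 q.2) ∘
          (fun q : (Ω ×ˢ Ω : Set (M × M)) => (⟨q.1.1, q.2.1⟩, ⟨q.1.2, q.2.2⟩)) := by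
      funext q; exact hw _ q.2.1 _ q.2.2
    rw [this]
    exact hcont.comp (by fun_prop)
  · intro y hy z hz
    rw [hw y hy.1 z hz.1]
    by_cases hyz : L.causal y z
    · by_cases hne : y = z
      · subst hne
        have h1 := W.reverse_triangle ⟨y, hy.1⟩ ⟨y, hy.1⟩ ⟨y, hy.1⟩
          (W.causal_refl _) (W.causal_refl _)
        have h2 : W.tau ⟨y, hy.1⟩ ⟨y, hy.1⟩ = 0 := by
          by_contra h0
          exact absurd h1 (not_le.2 (ENNReal.lt_add_right (hfin _ _) h0))
        rw [h2]; exact zero_le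
      · obtain ⟨γ, -, -, -, -, hle⟩ := hmax ⟨y, hy.1⟩ ⟨z, hz.1⟩ hyz
          (fun h => hne (congrArg Subtype.val h))
        exact hle
    · rw [W.tau_eq_zero _ _ (fun h' => hyz ((hcausal _ _).1 h'))]; exact zero_le
  · intro γ hγ hV
    rw [hw _ (hV 0).1 _ (hV 1).1]
    by_cases hne : γ 0 = γ 1
    · refine (tauLength_le_tau γ).trans ?_
      have h0 : L.tau (γ 0) (γ 1) = 0 := by rw [← hne, h.tau_self]
      rw [h0]; exact zero_le
    · obtain ⟨γ', hmax', h0, h1, hlen, -⟩ := hmax ⟨γ 0, (hV 0).1⟩ ⟨γ 1, (hV 1).1⟩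
        (hγ.2 0 1 zero_lt_one) (fun h => hne (congrArg Subtype.val h))
      rw [← hlen]
      exact hmax'.2.2 γ hγ (fun t => (hV t).1) h0.symm h1.symm
  · intro y _ z _ hcl
    have h1 := closure_mono (t := {q : M × M | q.1 ∈ closure U ∧ q.2 ∈ closure U ∧
      L.causal q.1 q.2}) (fun q hq => ⟨subset_closure hq.1.2, subset_closure hq.2.1.2, hq.2.2⟩) hcl
    rw [hUc.closure_eq] at h1
    exact h1.2.2

end Local

/-! ### Partitions and additivity of the `tau`-length. -/

section Partitions

variable {M : Type*} [MetricSpace M] (L : LorentzianPreLengthSpace M)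

/-- `S` is the sum of `tau` along `γ` over some partition of `[a, b]`. -/
inductive PartSum (γ : C(I, M)) : I → I → ℝ≥0∞ → Prop
  | nil (a : I) : PartSum γ a a 0
  | cons (a b c : I) (S : ℝ≥0∞) : a < b → PartSum γ b c S →
      PartSum γ a c (L.tau (γ a) (γ b) + S)

variable {L}

lemma PartSum.append {γ : C(I, M)} {a b c : I} {S T : ℝ≥0∞} (h : L.PartSum γ a b S)
    (h' : L.PartSum γ b c T) : L.PartSum γ a c (S + T) := by
  induction h with
  | nil a => simpa using h'
  | cons a b d S hab _ ih => rw [add_assoc]; exact .cons _ _ _ _ hab (ih h')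

lemma PartSum.exists_strictMono {γ : C(I, M)} {a b : I} {S : ℝ≥0∞} (h : L.PartSum γ a b S) :
    ∃ (n : ℕ) (t : Fin (n + 1) → I), StrictMono t ∧ t 0 = a ∧ t (Fin.last n) = b ∧
      ∑ i : Fin n, L.tau (γ (t i.castSucc)) (γ (t i.succ)) = S := by
  induction h with
  | nil a => exact ⟨0, fun _ => a, fun i j hij => absurd hij (by omega), rfl, rfl, by simp⟩
  | cons a b c S hab _ ih =>
    obtain ⟨n, t, ht, h0, h1, hS⟩ := ih
    refine ⟨n + 1, Fin.cons a t, ?_, rfl, ?_, ?_⟩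
    · rw [Fin.strictMono_iff_lt_succ]
      intro i
      refine Fin.cases ?_ (fun j => ?_) i
      · simpa [h0] using hab
      · rw [← Fin.succ_castSucc, Fin.cons_succ, Fin.cons_succ]
        exact ht j.castSucc_lt_succ
    · rw [← Fin.succ_last, Fin.cons_succ, h1]
    · rw [Fin.sum_univ_succ, ← hS]
      congr 1
      simp [h0]

lemma partSum_of_strictMono (γ : C(I, M)) (n : ℕ) (t : Fin (n + 1) → I) (ht : StrictMono t) :
    L.PartSum γ (t 0) (t (Fin.last n))
      (∑ i : Fin n, L.tau (γ (t i.castSucc)) (γ (t i.succ))) := by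
  induction n with
  | zero => simpa using PartSum.nil (t 0)
  | succ n ih =>
    rw [Fin.sum_univ_succ]
    have := ih (fun i => t i.succ) (fun i j hij => ht (Fin.succ_lt_succ_iff.2 hij))
    exact .cons _ _ _ _ (ht (by simp)) this

lemma PartSum.tauLength_le {γ : C(I, M)} {S : ℝ≥0∞} (h : L.PartSum γ 0 1 S) :
    L.tauLength γ ≤ S := by
  obtain ⟨n, t, ht, h0, h1, rfl⟩ := h.exists_strictMono
  exact iInf_le_of_le n (iInf_le_of_le t (iInf_le_of_le ht (iInf_le_of_le h0 (iInf_le _ h1))))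

/-- The affine map of `[0,1]` onto `[a,b]`. -/
def affineI (a b : I) (hab : a ≤ b) : C(I, I) where
  toFun s := ⟨a + s * (b - a), by
    have h1 := a.2.1
    have h2 := b.2.2
    have h3 : (a : ℝ) ≤ b := hab
    constructor
    · nlinarith [s.2.1]
    · nlinarith [s.2.2]⟩
  continuous_toFun := by fun_prop

@[simp] lemma coe_affineI {a b : I} (hab : a ≤ b) (s : I) :
    (affineI a b hab s : ℝ) = a + s * (b - a) := rfl

@[simp] lemma affineI_zero {a b : I} (hab : a ≤ b) : affineI a b hab 0 = a :=
  Subtype.ext (by simp)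

@[simp] lemma affineI_one {a b : I} (hab : a ≤ b) : affineI a b hab 1 = b :=
  Subtype.ext (by simp)

lemma monotone_affineI {a b : I} (hab : a ≤ b) : Monotone (affineI a b hab) := by
  intro s t hst
  have h3 : (a : ℝ) ≤ b := hab
  have h4 : (s : ℝ) ≤ t := hst
  rw [← Subtype.coe_le_coe, coe_affineI, coe_affineI]
  nlinarith

lemma strictMono_affineI {a b : I} (hab : a < b) : StrictMono (affineI a b hab.le) := by
  intro s t hst
  have h3 : (a : ℝ) < b := hab
  have h4 : (s : ℝ) < t := hst
  rw [← Subtype.coe_lt_coe, coe_affineI, coe_affineI]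
  nlinarith

lemma affineI_mem_Icc {a b : I} (hab : a ≤ b) (s : I) : affineI a b hab s ∈ Icc a b :=
  ⟨by simpa using monotone_affineI hab (zero_le : 0 ≤ s),
    by simpa using monotone_affineI hab (unitInterval.le_one' : s ≤ 1)⟩

lemma affineI_image_Icc {a b : I} (hab : a < b) {s t : I} (hst : s ≤ t) :
    affineI a b hab.le '' Icc s t = Icc (affineI a b hab.le s) (affineI a b hab.le t) := by
  apply Subset.antisymm
  · rintro _ ⟨r, hr, rfl⟩
    exact ⟨monotone_affineI _ hr.1, monotone_affineI _ hr.2⟩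
  · exact intermediate_value_Icc hst (affineI a b hab.le).continuous.continuousOn

/-- Local length bounds concern curves defined on all of [0,1], so arcs are rescaled affinely, which
preserves constant speed. -/
lemma IsCausalCurve.comp_affineI {γ : C(I, M)} (h : L.IsCausalCurve γ) {a b : I} (hab : a < b) :
    L.IsCausalCurve (γ.comp (affineI a b hab.le)) := by
  obtain ⟨⟨c, hc⟩, hγ⟩ := h
  have hab' : (a : ℝ) < b := hab
  refine ⟨⟨⟨c * (b - a), mul_nonneg c.2 (by linarith)⟩, fun s t hst => ?_⟩,
    fun s t hst => hγ _ _ (strictMono_affineI hab hst)⟩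
  rw [ContinuousMap.coe_comp,
    eVariationOn.comp_eq_of_monotoneOn _ _ ((monotone_affineI hab.le).monotoneOn _),
    affineI_image_Icc hab hst, hc _ _ (monotone_affineI hab.le hst)]
  congr 1
  simp only [coe_affineI]
  change _ = (c * (b - a) : ℝ) * (t - s)
  ring

lemma exists_partSum_le_tauLength_add (γ : C(I, M)) {a b : I} (hab : a < b) {ε : ℝ≥0∞}
    (hε : ε ≠ 0) (hfin : L.tauLength (γ.comp (affineI a b hab.le)) ≠ ∞) :
    ∃ S, L.PartSum γ a b S ∧ S ≤ L.tauLength (γ.comp (affineI a b hab.le)) + ε := by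
  have h1 := ENNReal.lt_add_right hfin hε
  nth_rewrite 1 [tauLength] at h1
  simp only [iInf_lt_iff] at h1
  obtain ⟨n, t, ht, h0, h1, hlt⟩ := h1
  have h2 := L.partSum_of_strictMono γ n (fun i => affineI a b hab.le (t i))
    (fun i j hij => strictMono_affineI hab (ht hij))
  simp only [h0, h1, affineI_zero, affineI_one] at h2
  exact ⟨_, h2, hlt.le⟩

/-- The `tau`-length of a causal curve is bounded by the sum of local time separations along a
subdivision subordinate to local pieces. -/
lemma tauLength_le_sum_of_isLocalPiece {γ : C(I, M)} (hγ : L.IsCausalCurve γ) {t : ℕ → I}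
    (ht : Monotone t) {V : ℕ → Set M} {w : ℕ → M → M → ℝ≥0∞}
    (hV : ∀ i, L.IsLocalPiece (V i) (w i)) {n : ℕ}
    (hsub : ∀ i < n, ∀ s ∈ Icc (t i) (t (i + 1)), γ s ∈ V i) (h0 : t 0 = 0) (h1 : t n = 1) :
    L.tauLength γ ≤ ∑ i ∈ Finset.range n, w i (γ (t i)) (γ (t (i + 1))) := by
  have key : ∀ (ε : ℝ≥0∞), ε ≠ 0 → ∀ k ≤ n, ∃ S, L.PartSum γ (t 0) (t k) S ∧
      S ≤ ∑ i ∈ Finset.range k, (w i (γ (t i)) (γ (t (i + 1))) + ε) := by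
    intro ε hε k hk
    induction k with
    | zero => exact ⟨0, .nil _, by simp⟩
    | succ k ih =>
      obtain ⟨S, hS, hle⟩ := ih (k.le_succ.trans hk)
      -- Subdivision points may repeat; a degenerate interval contributes nothing to the partition.
      rcases (ht k.le_succ).eq_or_lt with heq | hlt
      · refine ⟨S, by rw [Nat.succ_eq_add_one] at heq; rwa [← heq], hle.trans ?_⟩
        rw [Finset.sum_range_succ]; exact le_self_add
      · have hle' := (hV k).tauLength_le _ (hγ.comp_affineI hlt)
          (fun s => hsub k hk _ (affineI_mem_Icc _ s))
        simp only [ContinuousMap.comp_apply, affineI_zero, affineI_one] at hle'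
        have hfin := ne_top_of_le_ne_top ((hV k).ne_top _ (hsub k hk _ ⟨le_rfl, hlt.le⟩) _
          (hsub k hk _ ⟨hlt.le, le_rfl⟩)) hle'
        obtain ⟨T, hT, hTle⟩ := exists_partSum_le_tauLength_add γ hlt hε hfin
        refine ⟨S + T, hS.append hT, ?_⟩
        rw [Finset.sum_range_succ]
        gcongr
        exact hTle.trans (by gcongr)
  refine ENNReal.le_of_forall_pos_le_add fun ε hε _ => ?_
  -- The n errors then add up to at most ε; n + 1 instead of n avoids dividing by zero.
  have hε' : (ε : ℝ≥0∞) / (n + 1) ≠ 0 := by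
    simp [ENNReal.div_eq_zero_iff, hε.ne']
  obtain ⟨S, hS, hle⟩ := key _ hε' n le_rfl
  rw [h0, h1] at hS
  refine hS.tauLength_le.trans (hle.trans ?_)
  rw [Finset.sum_add_distrib]
  gcongr
  simp only [Finset.sum_const, Finset.card_range, nsmul_eq_mul]
  rw [← mul_div_assoc]
  refine ENNReal.div_le_of_le_mul ?_
  rw [mul_comm]
  gcongr
  exact le_self_add

lemma sum_tau_le {x : ℕ → M} (hx : ∀ i, L.causal (x i) (x (i + 1))) (n : ℕ) :
    L.causal (x 0) (x n) ∧
      ∑ i ∈ Finset.range n, L.tau (x i) (x (i + 1)) ≤ L.tau (x 0) (x n) := by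
  induction n with
  | zero => exact ⟨L.causal_refl _, by simp⟩
  | succ n ih =>
    refine ⟨L.causal_trans _ _ _ ih.1 (hx n), ?_⟩
    rw [Finset.sum_range_succ]
    refine le_trans ?_ (L.reverse_triangle _ _ _ ih.1 (hx n))
    gcongr
    exact ih.2

/-- Every continuous curve has a finite subdivision subordinate to local pieces. -/
lemma exists_subdivision (h : L.Localizable) (hc : L.LocallyCausallyClosed) (γ : C(I, M)) :
    ∃ (t : ℕ → I) (n : ℕ) (V : ℕ → Set M) (w : ℕ → M → M → ℝ≥0∞), Monotone t ∧ t 0 = 0 ∧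
      t n = 1 ∧ (∀ i, L.IsLocalPiece (V i) (w i)) ∧
      ∀ i, ∀ s ∈ Icc (t i) (t (i + 1)), γ s ∈ V i := by
  choose V w hV hmem using fun s : I => h.exists_isLocalPiece hc (γ s)
  obtain ⟨t, h0, ht, ⟨n, hn⟩, hsub⟩ := exists_monotone_Icc_subset_open_cover_unitInterval
    (c := fun s => γ ⁻¹' V s) (fun s => (hV s).isOpen.preimage γ.continuous)
    (fun s _ => mem_iUnion.2 ⟨s, hmem s⟩)
  choose i hi using hsub
  exact ⟨t, n, fun k => V (i k), fun k => w (i k), ht, h0, hn n le_rfl, fun k => hV _,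
    fun k s hs => hi k hs⟩

end Partitions

end TimelikeCD.LorentzianPreLengthSpace

end

noncomputable section

namespace TimelikeCD.LorentzianPreLengthSpace

open Filter Topology

/-! ### Finiteness and continuity of the time separation. -/

section Continuity

variable {M : Type*} [MetricSpace M]

/-- The speed of a constant-speed curve on [0,1] is its length, so uniform length bounds become
uniform Lipschitz bounds. -/
lemma HasConstantSpeed.lipschitzWith {γ : C(I, M)} (h : HasConstantSpeed γ) {C : ℝ≥0}
    (hC : metricLength γ ≤ C) : LipschitzWith C γ := by
  obtain ⟨c, hc⟩ := h
  have hcC : (c : ℝ) ≤ C := by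
    have h1 := hc 0 1 zero_le_one
    have h2 : Icc (0 : I) 1 = univ := eq_univ_of_forall fun t => ⟨zero_le, unitInterval.le_one'⟩
    rw [h2] at h1
    rw [metricLength, h1] at hC
    simpa using hC
  have key : ∀ s t : I, s ≤ t → dist (γ s) (γ t) ≤ C * dist s t := by
    intro s t hst
    have hst' : (s : ℝ) ≤ t := hst
    have h1 := eVariationOn.edist_le γ (left_mem_Icc.2 hst) (right_mem_Icc.2 hst)
    rw [hc s t hst, edist_dist, ENNReal.ofReal_le_ofReal_iff
      (mul_nonneg c.coe_nonneg (by linarith : (0 : ℝ) ≤ t - s))] at h1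
    rw [dist_comm s t, Subtype.dist_eq, Real.dist_eq, abs_of_nonneg (by linarith)]
    exact h1.trans (mul_le_mul_of_nonneg_right hcC (by linarith))
  refine LipschitzWith.of_dist_le_mul fun s t => ?_
  rcases le_total s t with h | h
  · exact key s t h
  · rw [dist_comm, dist_comm s]; exact key t s h

/-- Arzelà–Ascoli: pointwise, the set is a closed subset of a power of `J`, compact by Tychonoff,
and a common Lipschitz constant gives equicontinuity. -/
lemma isCompact_setOf_lipschitzWith {J : Set M} (hJ : IsCompact J) (C : ℝ≥0) :
    IsCompact {γ : C(I, M) | LipschitzWith C γ ∧ ∀ t, γ t ∈ J} := by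
  apply ArzelaAscoli.isCompact_of_equicontinuous
  · have : ContinuousMap.toFun '' {γ : C(I, M) | LipschitzWith C γ ∧ ∀ t, γ t ∈ J} =
        (univ.pi fun _ => J) ∩ {f : I → M | LipschitzWith C f} := by
      ext f
      constructor
      · rintro ⟨γ, ⟨h1, h2⟩, rfl⟩
        exact ⟨fun t _ => h2 t, h1⟩
      · rintro ⟨h1, h2⟩
        exact ⟨⟨f, h2.continuous⟩, ⟨h2, fun t => h1 t (mem_univ _)⟩, rfl⟩
    rw [this]
    exact (isCompact_univ_pi fun _ => hJ).inter_right (isClosed_setOfPred_lipschitzWith C)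
  · exact (LipschitzWith.uniformEquicontinuous _ C fun γ => γ.2.1).equicontinuous

variable {L : LorentzianPreLengthSpace M}

lemma causal_of_geo {γ : C(I, M)} (h : γ ∈ L.Geo) {s t : I} (hst : s ≤ t) :
    L.causal (γ s) (γ t) := by
  rcases hst.eq_or_lt with rfl | hlt
  · exact L.causal_refl _
  · exact h.1.2 s t hlt

/-- Along a geodesic, `tau` of the endpoints equals the `tau`-length, which is at most a finite sum
of finite local time separations. -/
lemma tau_ne_top_of_geo (hloc : L.Localizable) (hc : L.LocallyCausallyClosed) {γ : C(I, M)}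
    (h : γ ∈ L.Geo) : L.tau (γ 0) (γ 1) ≠ ∞ := by
  obtain ⟨t, n, V, w, ht, h0, h1, hV, hsub⟩ := exists_subdivision hloc hc γ
  rw [← h.2]
  refine ne_top_of_le_ne_top ?_
    (tauLength_le_sum_of_isLocalPiece h.1 ht hV (fun i _ => hsub i) h0 h1)
  refine ENNReal.sum_ne_top.2 fun i _ => (hV i).ne_top _ ?_ _ ?_
  · exact hsub i _ ⟨le_rfl, ht i.le_succ⟩
  · exact hsub i _ ⟨ht i.le_succ, le_rfl⟩

/-- The time separation of the endpoints is upper semicontinuous along uniformly converging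
geodesics. -/
lemma le_tau_of_tendsto_geo (hloc : L.Localizable) (hc : L.LocallyCausallyClosed)
    {g : ℕ → C(I, M)} (hg : ∀ k, g k ∈ L.Geo) {γ : C(I, M)} (hlim : Tendsto g atTop (𝓝 γ))
    {R : ℝ≥0∞} (hR : ∀ k, R ≤ L.tau (g k 0) (g k 1)) : R ≤ L.tau (γ 0) (γ 1) := by
  obtain ⟨t, n, V, w, ht, h0, h1, hV, hsub⟩ := exists_subdivision hloc hc γ
  have hev : ∀ s, Tendsto (fun k => g k s) atTop (𝓝 (γ s)) := fun s =>
    ((continuous_eval_const s).tendsto γ).comp hlim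
  have hlow : ∀ i, γ (t i) ∈ V i := fun i => hsub i _ ⟨le_rfl, ht i.le_succ⟩
  have hupp : ∀ i, γ (t (i + 1)) ∈ V i := fun i => hsub i _ ⟨ht i.le_succ, le_rfl⟩
  -- By uniform convergence, the subdivision chosen for the limit is eventually subordinate for `g
  -- k` as well.
  have hmem : ∀ i, ∀ᶠ k in atTop, ∀ s ∈ Icc (t i) (t (i + 1)), g k s ∈ V i := by
    intro i
    exact hlim.eventually
      (ContinuousMap.eventually_mapsTo isCompact_Icc (hV i).isOpen (fun s hs => hsub i s hs))
  -- The limit curve is not claimed to be causal with constant speed; causality between consecutive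
  -- subdivision points is enough for the reverse triangle inequality.
  have hcausal : ∀ i, L.causal (γ (t i)) (γ (t (i + 1))) := by
    intro i
    refine (hV i).causal_of_mem_closure _ (hlow i) _ (hupp i) ?_
    refine mem_closure_of_tendsto ((hev (t i)).prodMk_nhds (hev (t (i + 1)))) ?_
    filter_upwards [hmem i] with k hk
    exact ⟨hk _ ⟨le_rfl, ht i.le_succ⟩, hk _ ⟨ht i.le_succ, le_rfl⟩,
      causal_of_geo (hg k) (ht i.le_succ)⟩
  have hw : ∀ i, Tendsto (fun k => w i (g k (t i)) (g k (t (i + 1)))) atTop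
      (𝓝 (w i (γ (t i)) (γ (t (i + 1))))) := by
    intro i
    have hopen : (V i ×ˢ V i) ∈ 𝓝 (γ (t i), γ (t (i + 1))) :=
      prod_mem_nhds ((hV i).isOpen.mem_nhds (hlow i)) ((hV i).isOpen.mem_nhds (hupp i))
    exact (((hV i).continuousOn.continuousAt hopen).tendsto).comp
      ((hev (t i)).prodMk_nhds (hev (t (i + 1))))
  have hbound : ∀ᶠ k in atTop, R ≤
      ∑ i ∈ Finset.range n, w i (g k (t i)) (g k (t (i + 1))) := by
    have hall : ∀ᶠ k in atTop, ∀ i ∈ Finset.range n, ∀ s ∈ Icc (t i) (t (i + 1)),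
        g k s ∈ V i := (Filter.eventually_all_finset _).2 fun i _ => hmem i
    filter_upwards [hall] with k hk
    refine (hR k).trans ?_
    rw [← (hg k).2]
    exact tauLength_le_sum_of_isLocalPiece (hg k).1 ht hV
      (fun i hi => hk i (Finset.mem_range.2 hi)) h0 h1
  -- Only the continuous functions `w i` are passed to the limit; `tau` enters afterwards through `w
  -- i ≤ tau`.
  have h2 := ge_of_tendsto (tendsto_finsetSum (Finset.range n) fun i _ => hw i) hbound
  refine h2.trans ?_
  have h3 := (sum_tau_le (x := fun i => γ (t i)) hcausal n).2
  simp only [h0, h1] at h3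
  exact (Finset.sum_le_sum fun i _ => (hV i).le_tau _ (hlow i) _ (hupp i)).trans h3

lemma isOpen_setOf_chron : IsOpen {q : M × M | L.chron q.1 q.2} := by
  have := L.lowerSemicontinuous_tau.isOpen_preimage 0
  convert this using 1
  ext q
  exact (L.tau_pos_iff _ _).symm

theorem tau_ne_top (hc : L.LocallyCausallyClosed) (hgeo : L.IsGeodesicSpace) (x y : M) :
    L.tau x y ≠ ∞ := by
  by_cases hxy : x = y
  · subst hxy; rw [hgeo.1.tau_self]; exact ENNReal.zero_ne_top
  by_cases h : L.causal x y
  · obtain ⟨η, hη, rfl, rfl⟩ := hgeo.2 x y h hxy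
    exact tau_ne_top_of_geo hgeo.1 hc hη
  · rw [L.tau_eq_zero _ _ h]; exact ENNReal.zero_ne_top

theorem continuous_tau (hc : L.LocallyCausallyClosed) (hgh : L.GloballyHyperbolic)
    (hgeo : L.IsGeodesicSpace) : Continuous (fun q : M × M => L.tau q.1 q.2) := by
  refine continuous_iff_lower_upperSemicontinuous.2 ⟨L.lowerSemicontinuous_tau, ?_⟩
  rintro ⟨x, y⟩ R hR
  by_contra hcon
  rw [Filter.not_eventually] at hcon
  obtain ⟨a, hax⟩ := (hgeo.1.exists_chron x).1
  obtain ⟨b, hyb⟩ := (hgeo.1.exists_chron y).2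
  have hnear : ∀ᶠ q : M × M in 𝓝 (x, y), L.chron a q.1 ∧ L.chron q.2 b := by
    refine Filter.Eventually.and ?_ ?_
    · exact (isOpen_setOf_chron (L := L)).preimage
        (continuous_const.prodMk continuous_fst) |>.mem_nhds hax
    · exact (isOpen_setOf_chron (L := L)).preimage
        (continuous_snd.prodMk continuous_const) |>.mem_nhds hyb
  obtain ⟨q, hq, hqp⟩ := exists_seq_forall_of_frequently (hcon.and_eventually hnear)
  have hRq : ∀ k, R ≤ L.tau (q k).1 (q k).2 := fun k => not_lt.1 (hqp k).1
  have hgk : ∀ k, ∃ g ∈ L.Geo, g 0 = (q k).1 ∧ g 1 = (q k).2 := by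
    intro k
    -- `R` exceeds `tau x y`, hence is positive; so the approximating pairs are chronological, and
    -- distinct because `tau` vanishes on the diagonal.
    have hpos : 0 < L.tau (q k).1 (q k).2 := (zero_le.trans_lt hR).trans_le (hRq k)
    refine hgeo.2 _ _ (L.causal_of_chron _ _ ((L.tau_pos_iff _ _).1 hpos)) fun h => ?_
    rw [h, hgeo.1.tau_self] at hpos
    exact hpos.false
  choose g hg hg0 hg1 using hgk
  -- Both halves of global hyperbolicity are used: the diamond is compact, and causal curves in it
  -- have bounded length.
  obtain ⟨C, hC⟩ := hgh.1 _ (hgh.2 a b)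
  have hJ : ∀ k t, g k t ∈ L.causalDiamond a b := fun k t =>
    ⟨L.causal_trans _ _ _ (L.causal_of_chron _ _ (hqp k).2.1)
        (hg0 k ▸ causal_of_geo (hg k) zero_le),
      L.causal_trans _ _ _ (hg1 k ▸ causal_of_geo (hg k) unitInterval.le_one')
        (L.causal_of_chron _ _ (hqp k).2.2)⟩
  obtain ⟨γ, -, φ, hφ, hlim⟩ := (isCompact_setOf_lipschitzWith (hgh.2 a b) C).tendsto_subseq
    (x := g) fun k => ⟨(hg k).1.1.lipschitzWith (hC _ (hg k).1 (hJ k)), hJ k⟩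
  have hle := le_tau_of_tendsto_geo hgeo.1 hc (fun k => hg (φ k)) hlim (R := R)
    (fun k => by rw [hg0, hg1]; exact hRq _)
  have hev : ∀ s, Tendsto (fun k => g (φ k) s) atTop (𝓝 (γ s)) := fun s =>
    ((continuous_eval_const s).tendsto γ).comp hlim
  have hqφ := hq.comp hφ.tendsto_atTop
  have h0 : γ 0 = x := tendsto_nhds_unique (hev 0) (by
    simp only [hg0]; exact (continuous_fst.tendsto (x, y)).comp hqφ)
  have h1 : γ 1 = y := tendsto_nhds_unique (hev 1) (by
    simp only [hg1]; exact (continuous_snd.tendsto (x, y)).comp hqφ)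
  rw [h0, h1] at hle
  exact absurd hR (not_lt.2 hle)

end Continuity

end TimelikeCD.LorentzianPreLengthSpace

end

noncomputable section

namespace TimelikeCD

set_option linter.unusedSectionVars false

open Filter Topology

/-! ### Kantorovich duality on compact spaces. -/

section Kantorovich

variable {X Y : Type*} [MetricSpace X] [CompactSpace X] [MeasurableSpace X] [BorelSpace X]
  [MetricSpace Y] [CompactSpace Y] [MeasurableSpace Y] [BorelSpace Y]

lemma integrable_continuousMap (μ : Measure X) [IsFiniteMeasure μ] (f : C(X, ℝ)) :
    Integrable f μ :=
  f.continuous.integrable_of_hasCompactSupport (HasCompactSupport.of_compactSpace _)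

lemma integral_fst_add_snd {μ : Measure X} {ν : Measure Y} [IsFiniteMeasure μ]
    [IsFiniteMeasure ν] {π : Measure (X × Y)} (h1 : π.fst = μ) (h2 : π.snd = ν)
    (u : C(X, ℝ)) (v : C(Y, ℝ)) :
    Integrable (fun z : X × Y => u z.1 + v z.2) π ∧
      ∫ z, (u z.1 + v z.2) ∂π = ∫ x, u x ∂μ + ∫ y, v y ∂ν := by
  subst h1 h2
  have i1 : Integrable (fun z : X × Y => u z.1) π :=
    (integrable_continuousMap π.fst u).comp_measurable measurable_fst
  have i2 : Integrable (fun z : X × Y => v z.2) π :=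
    (integrable_continuousMap π.snd v).comp_measurable measurable_snd
  refine ⟨i1.add i2, ?_⟩
  rw [integral_add i1 i2, Measure.fst, Measure.snd,
    integral_map measurable_fst.aemeasurable u.continuous.aestronglyMeasurable,
    integral_map measurable_snd.aemeasurable v.continuous.aestronglyMeasurable]

/-- The values of the dual Kantorovich problem for the cost `f`. -/
def dualValues (μ : Measure X) (ν : Measure Y) (f : C(X × Y, ℝ)) : Set ℝ :=
  {r | ∃ (u : C(X, ℝ)) (v : C(Y, ℝ)), (∀ z, f z ≤ u z.1 + v z.2) ∧
    ∫ x, u x ∂μ + ∫ y, v y ∂ν = r}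

variable (μ : Measure X) (ν : Measure Y)

lemma dualValues_nonempty (f : C(X × Y, ℝ)) : (dualValues μ ν f).Nonempty :=
  ⟨_, ContinuousMap.const _ ‖f‖, 0, fun z => by
    simpa using (le_abs_self _).trans (f.norm_coe_le_norm z), rfl⟩

variable [IsProbabilityMeasure μ] [IsProbabilityMeasure ν]

lemma integral_le_of_mem_dualValues {f : C(X × Y, ℝ)} {r : ℝ} (h : r ∈ dualValues μ ν f)
    {π : Measure (X × Y)} (h1 : π.fst = μ) (h2 : π.snd = ν) : ∫ z, f z ∂π ≤ r := by
  obtain ⟨u, v, hf, rfl⟩ := h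
  have : IsProbabilityMeasure π := ⟨by rw [← Measure.fst_univ, h1, measure_univ]⟩
  obtain ⟨hi, he⟩ := integral_fst_add_snd h1 h2 u v
  rw [← he]
  exact integral_mono (integrable_continuousMap π f) hi hf

lemma bddBelow_dualValues (f : C(X × Y, ℝ)) : BddBelow (dualValues μ ν f) :=
  ⟨∫ z, f z ∂(μ.prod ν), fun _ hr =>
    integral_le_of_mem_dualValues μ ν hr Measure.fst_prod Measure.snd_prod⟩

/-- The optimal value of the dual Kantorovich problem. -/
def dualValue (f : C(X × Y, ℝ)) : ℝ := sInf (dualValues μ ν f)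

lemma dualValue_le {f : C(X × Y, ℝ)} {u : C(X, ℝ)} {v : C(Y, ℝ)}
    (h : ∀ z, f z ≤ u z.1 + v z.2) : dualValue μ ν f ≤ ∫ x, u x ∂μ + ∫ y, v y ∂ν :=
  csInf_le (bddBelow_dualValues μ ν f) ⟨u, v, h, rfl⟩

lemma exists_lt_dualValue_add (f : C(X × Y, ℝ)) {ε : ℝ} (hε : 0 < ε) :
    ∃ (u : C(X, ℝ)) (v : C(Y, ℝ)), (∀ z, f z ≤ u z.1 + v z.2) ∧
      ∫ x, u x ∂μ + ∫ y, v y ∂ν < dualValue μ ν f + ε := by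
  obtain ⟨r, ⟨u, v, h, rfl⟩, hlt⟩ := exists_lt_of_csInf_lt (dualValues_nonempty μ ν f)
    (lt_add_of_pos_right (dualValue μ ν f) hε)
  exact ⟨u, v, h, hlt⟩

lemma dualValue_add_le (f g : C(X × Y, ℝ)) :
    dualValue μ ν (f + g) ≤ dualValue μ ν f + dualValue μ ν g := by
  refine le_of_forall_pos_le_add fun ε hε => ?_
  obtain ⟨u, v, h, hlt⟩ := exists_lt_dualValue_add μ ν f (half_pos hε)
  obtain ⟨u', v', h', hlt'⟩ := exists_lt_dualValue_add μ ν g (half_pos hε)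
  have := dualValue_le μ ν (f := f + g) (u := u + u') (v := v + v') (fun z => by
    simp only [ContinuousMap.add_apply]; linarith [h z, h' z])
  simp only [ContinuousMap.add_apply] at this
  rw [integral_add (integrable_continuousMap μ u) (integrable_continuousMap μ u'),
    integral_add (integrable_continuousMap ν v) (integrable_continuousMap ν v')] at this
  linarith

lemma dualValue_smul_le {a : ℝ} (ha : 0 < a) (f : C(X × Y, ℝ)) :
    dualValue μ ν (a • f) ≤ a * dualValue μ ν f := by
  refine le_of_forall_pos_le_add fun ε hε => ?_
  obtain ⟨u, v, h, hlt⟩ := exists_lt_dualValue_add μ ν f (div_pos hε ha)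
  have := dualValue_le μ ν (f := a • f) (u := a • u) (v := a • v) (fun z => by
    simp only [ContinuousMap.smul_apply, smul_eq_mul]; nlinarith [h z])
  simp only [ContinuousMap.smul_apply, smul_eq_mul, integral_const_mul] at this
  have h2 : a * (dualValue μ ν f + ε / a) = a * dualValue μ ν f + ε := by field_simp
  nlinarith

lemma dualValue_smul {a : ℝ} (ha : 0 < a) (f : C(X × Y, ℝ)) :
    dualValue μ ν (a • f) = a * dualValue μ ν f := by
  refine le_antisymm (dualValue_smul_le μ ν ha f) ?_
  have := dualValue_smul_le μ ν (inv_pos.2 ha) (a • f)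
  rw [smul_smul, inv_mul_cancel₀ ha.ne', one_smul] at this
  calc a * dualValue μ ν f ≤ a * (a⁻¹ * dualValue μ ν (a • f)) := by gcongr
    _ = _ := by field_simp

lemma dualValue_zero : dualValue μ ν (0 : C(X × Y, ℝ)) = 0 := by
  have := dualValue_smul μ ν two_pos (0 : C(X × Y, ℝ))
  rw [smul_zero] at this
  linarith

/-- Hahn–Banach: a linear functional below `dualValue` that agrees with it at `c`. -/
lemma exists_linearMap_le_dualValue (c : C(X × Y, ℝ)) :
    ∃ g : C(X × Y, ℝ) →ₗ[ℝ] ℝ, g c = dualValue μ ν c ∧ ∀ f, g f ≤ dualValue μ ν f := by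
  -- This settles domination by `dualValue` on negative multiples of `c`.
  have hneg : ∀ f : C(X × Y, ℝ), -dualValue μ ν f ≤ dualValue μ ν (-f) := by
    intro f
    have := dualValue_add_le μ ν f (-f)
    rw [add_neg_cancel, dualValue_zero] at this
    linarith
  have H : ∀ a : ℝ, a • c = 0 → (RingHom.id ℝ a) • dualValue μ ν c = 0 := by
    intro a ha
    rcases smul_eq_zero.1 ha with rfl | rfl
    · simp
    · rw [dualValue_zero, smul_zero]
  obtain ⟨g, hg, hle⟩ := exists_extension_of_le_sublinear
    (LinearPMap.mkSpanSingleton' c (dualValue μ ν c) H) (dualValue μ ν)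
    (fun a ha f => dualValue_smul μ ν ha f) (dualValue_add_le μ ν) (by
      rintro ⟨f, hf⟩
      obtain ⟨a, rfl⟩ := Submodule.mem_span_singleton.1 hf
      rw [LinearPMap.mkSpanSingleton'_apply]
      simp only [RingHom.id_apply, smul_eq_mul]
      rcases lt_trichotomy a 0 with h | rfl | h
      · have h1 := hneg ((-a) • c)
        rw [dualValue_smul μ ν (neg_pos.2 h), ← neg_smul, neg_neg] at h1
        linarith
      · rw [zero_mul, zero_smul, dualValue_zero]
      · rw [dualValue_smul μ ν h])
  refine ⟨g, ?_, hle⟩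
  have hc : c ∈ (LinearPMap.mkSpanSingleton' c (dualValue μ ν c) H).domain :=
    Submodule.mem_span_singleton_self c
  exact (hg ⟨c, hc⟩).trans (LinearPMap.mkSpanSingleton'_apply_self _ _ _ hc)

/-- Kantorovich duality on compact spaces, with existence of an optimal coupling. -/
lemma exists_coupling_integral_eq_dualValue (c : C(X × Y, ℝ)) :
    ∃ π : Measure (X × Y), π.fst = μ ∧ π.snd = ν ∧ ∫ z, c z ∂π = dualValue μ ν c := by
  obtain ⟨g, hgc, hle⟩ := exists_linearMap_le_dualValue μ ν c
  -- Zero potentials are admissible for `-f`, so domination by `dualValue` makes `g` positive and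
  -- hence represented by a measure.
  have hpos : ∀ f : C(X × Y, ℝ), (∀ z, 0 ≤ f z) → 0 ≤ g f := by
    intro f hf
    have h1 := (hle (-f)).trans (dualValue_le μ ν (u := 0) (v := 0) (fun z => by
      simpa using hf z))
    simp only [map_neg, ContinuousMap.zero_apply, integral_zero] at h1
    linarith
  let Λ : CompactlySupportedContinuousMap (X × Y) ℝ →ₚ[ℝ] ℝ :=
    { toFun := fun f => g f.toContinuousMap
      map_add' := fun f f' => g.map_add f.toContinuousMap f'.toContinuousMap
      map_smul' := fun a f => g.map_smul a f.toContinuousMap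
      monotone' := fun f f' hff' => by
        have h1 := hpos (f'.toContinuousMap - f.toContinuousMap) fun z =>
          sub_nonneg.2 (hff' z)
        rw [map_sub] at h1
        exact sub_nonneg.1 h1 }
  let π := RealRMK.rieszMeasure Λ
  have hint : ∀ f : C(X × Y, ℝ), ∫ z, f z ∂π = g f := fun f =>
    RealRMK.integral_rieszMeasure Λ
      ⟨f, HasCompactSupport.of_compactSpace _⟩
  -- A separable cost is its own pair of potentials. Applied to `f` and `-f` in one variable, this
  -- bound forces the marginals to be `μ` and `ν`.
  have hsum : ∀ (u : C(X, ℝ)) (v : C(Y, ℝ)),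
      g (u.comp ⟨Prod.fst, continuous_fst⟩ + v.comp ⟨Prod.snd, continuous_snd⟩) ≤
        ∫ x, u x ∂μ + ∫ y, v y ∂ν := fun u v =>
    (hle _).trans (dualValue_le μ ν fun z => le_rfl)
  refine ⟨π, ?_, ?_, by rw [hint, hgc]⟩
  · refine ext_of_forall_integral_eq_of_IsFiniteMeasure fun f => ?_
    rw [Measure.fst, integral_map measurable_fst.aemeasurable
      f.continuous.aestronglyMeasurable]
    have h0 : ∫ z, f z.1 ∂π = g ((f : C(X, ℝ)).comp ⟨Prod.fst, continuous_fst⟩) :=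
      hint ((f : C(X, ℝ)).comp ⟨Prod.fst, continuous_fst⟩)
    have h1 := hsum f 0
    have h2 := hsum (-f) 0
    rw [ContinuousMap.zero_comp, add_zero] at h1 h2
    have h3 : (-(f : C(X, ℝ))).comp ⟨(Prod.fst : X × Y → X), continuous_fst⟩ =
      -((f : C(X, ℝ)).comp ⟨Prod.fst, continuous_fst⟩) := rfl
    rw [h3, map_neg] at h2
    simp only [ContinuousMap.neg_apply, ContinuousMap.zero_apply, integral_zero,
      integral_neg, add_zero] at h1 h2
    rw [h0]
    exact le_antisymm h1 (neg_le_neg_iff.1 h2)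
  · refine ext_of_forall_integral_eq_of_IsFiniteMeasure fun f => ?_
    rw [Measure.snd, integral_map measurable_snd.aemeasurable
      f.continuous.aestronglyMeasurable]
    have h0 : ∫ z, f z.2 ∂π = g ((f : C(Y, ℝ)).comp ⟨Prod.snd, continuous_snd⟩) :=
      hint ((f : C(Y, ℝ)).comp ⟨Prod.snd, continuous_snd⟩)
    have h1 := hsum 0 f
    have h2 := hsum 0 (-f)
    rw [ContinuousMap.zero_comp, zero_add] at h1 h2
    have h3 : (-(f : C(Y, ℝ))).comp ⟨(Prod.snd : X × Y → Y), continuous_snd⟩ =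
      -((f : C(Y, ℝ)).comp ⟨Prod.snd, continuous_snd⟩) := rfl
    rw [h3, map_neg] at h2
    simp only [ContinuousMap.neg_apply, ContinuousMap.zero_apply, integral_zero,
      integral_neg, zero_add] at h1 h2
    rw [h0]
    exact le_antisymm h1 (neg_le_neg_iff.1 h2)

/-- Almost optimal Kantorovich potentials with values in the range of the cost. -/
lemma exists_bounded_potentials {c : C(X × Y, ℝ)} {C : ℝ} (h0 : ∀ z, 0 ≤ c z)
    (hC : ∀ z, c z ≤ C) {ε : ℝ} (hε : 0 < ε) :
    ∃ (u : C(X, ℝ)) (v : C(Y, ℝ)), (∀ x, u x ∈ Icc 0 C) ∧ (∀ y, v y ∈ Icc 0 C) ∧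
      (∀ z, c z ≤ u z.1 + v z.2) ∧ ∫ x, u x ∂μ + ∫ y, v y ∂ν < dualValue μ ν c + ε := by
  obtain ⟨u, v, h, hlt⟩ := exists_lt_dualValue_add μ ν c hε
  have hX : Nonempty X := nonempty_of_isProbabilityMeasure μ
  obtain ⟨y₀⟩ : Nonempty Y := nonempty_of_isProbabilityMeasure ν
  obtain ⟨x₀, hx₀⟩ := u.continuous.exists_forall_le_of_hasCompactSupport
    (HasCompactSupport.of_compactSpace _)
  have hC0 : 0 ≤ C := (h0 (x₀, y₀)).trans (hC _)
  -- Shifting by the minimum of `u` makes both potentials nonnegative, since v + u x₀ ≥ c(x₀, ·) ≥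
  -- 0. Truncation at `C` keeps admissibility: a truncated potential alone already dominates `c`.
  refine ⟨(u - ContinuousMap.const _ (u x₀)) ⊓ ContinuousMap.const _ C,
    (v + ContinuousMap.const _ (u x₀)) ⊓ ContinuousMap.const _ C, fun x => ?_, fun y => ?_,
    fun z => ?_, lt_of_le_of_lt ?_ hlt⟩
  · simp [hx₀ x, hC0]
  · have := h0 (x₀, y)
    have := h (x₀, y)
    simp only [ContinuousMap.inf_apply, ContinuousMap.add_apply, ContinuousMap.const_apply,
      mem_Icc, le_inf_iff, inf_le_right, and_true]
    exact ⟨by linarith, hC0⟩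
  · have h1 := h z
    have h2 := hC z
    have h3 := hx₀ z.1
    have h4 := h0 (x₀, z.2)
    have h5 := h (x₀, z.2)
    simp only [ContinuousMap.inf_apply, ContinuousMap.add_apply, ContinuousMap.sub_apply,
      ContinuousMap.const_apply]
    rcases le_total (u z.1 - u x₀) C with h6 | h6 <;>
      rcases le_total (v z.2 + u x₀) C with h7 | h7 <;> simp only [h6, h7, inf_of_le_left,
        inf_of_le_right] <;> linarith
  · have e1 : ∫ x, ((u - ContinuousMap.const _ (u x₀)) ⊓ ContinuousMap.const _ C :
        C(X, ℝ)) x ∂μ ≤ ∫ x, u x ∂μ - u x₀ := by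
      refine (integral_mono (integrable_continuousMap μ _) (integrable_continuousMap μ
        (u - ContinuousMap.const _ (u x₀))) fun x => inf_le_left).trans (le_of_eq ?_)
      simp only [ContinuousMap.sub_apply, ContinuousMap.const_apply]
      rw [integral_sub (integrable_continuousMap μ u) (integrable_const _)]
      simp
    have e2 : ∫ y, ((v + ContinuousMap.const _ (u x₀)) ⊓ ContinuousMap.const _ C :
        C(Y, ℝ)) y ∂ν ≤ ∫ y, v y ∂ν + u x₀ := by
      refine (integral_mono (integrable_continuousMap ν _) (integrable_continuousMap ν
        (v + ContinuousMap.const _ (u x₀))) fun x => inf_le_left).trans (le_of_eq ?_)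
      simp only [ContinuousMap.add_apply, ContinuousMap.const_apply]
      rw [integral_add (integrable_continuousMap ν v) (integrable_const _)]
      simp
    linarith

/-- For a nonnegative continuous cost on compact spaces there are an optimal coupling and a
cyclically monotone Borel set that carries exactly the optimal couplings. -/
theorem exists_optimal_coupling_and_set (c : C(X × Y, ℝ)) (h0 : ∀ z, 0 ≤ c z) :
    ∃ (π : Measure (X × Y)) (G : Set (X × Y)), π.fst = μ ∧ π.snd = ν ∧ MeasurableSet G ∧
      (∀ (n : ℕ) (z : Fin (n + 1) → X × Y), (∀ i, z i ∈ G) →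
        ∑ i, c ((z (i + 1)).1, (z i).2) ≤ ∑ i, c (z i)) ∧
      ∀ ϖ : Measure (X × Y), ϖ.fst = μ → ϖ.snd = ν →
        ∫ z, c z ∂ϖ ≤ ∫ z, c z ∂π ∧ (∫ z, c z ∂ϖ = ∫ z, c z ∂π ↔ ϖ G = 1) := by
  have hC : ∀ z, c z ≤ ‖c‖ := fun z => (le_abs_self _).trans (c.norm_coe_le_norm z)
  obtain ⟨π, hπ1, hπ2, hπ⟩ := exists_coupling_integral_eq_dualValue μ ν c
  -- The errors 2⁻ⁿ are summable, so for an optimal coupling the gaps tend to zero almost everywhere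
  -- without passing to a subsequence.
  choose u v hu hv huv hlt using fun n : ℕ =>
    exists_bounded_potentials μ ν h0 hC (pow_pos (one_half_pos (α := ℝ)) n)
  let gap : ℕ → C(X × Y, ℝ) := fun n =>
    (u n).comp ⟨Prod.fst, continuous_fst⟩ + (v n).comp ⟨Prod.snd, continuous_snd⟩ - c
  have hgap : ∀ n z, gap n z = u n z.1 + v n z.2 - c z := fun n z => rfl
  have hgap0 : ∀ n z, 0 ≤ gap n z := fun n z => sub_nonneg.2 (huv n z)
  let G : Set (X × Y) := {z | Tendsto (fun n => gap n z) atTop (𝓝 0)}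
  have hG : MeasurableSet G := measurableSet_tendsto _ fun n => (gap n).continuous.measurable
  refine ⟨π, G, hπ1, hπ2, hG, ?_, ?_⟩
  · intro n z hz
    have hlim : Tendsto (fun k => ∑ i, (c (z i) + gap k (z i))) atTop
        (𝓝 (∑ i, (c (z i) + 0))) :=
      tendsto_finsetSum _ fun i _ => tendsto_const_nhds.add (hz i)
    simp only [add_zero] at hlim
    refine ge_of_tendsto' hlim fun k => ?_
    -- The cyclic shift permutes the terms of `u k` and leaves their sum unchanged.
    have hsum : ∑ i, (c (z i) + gap k (z i)) = ∑ i, (u k (z (i + 1)).1 + v k (z i).2) := by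
      simp only [hgap, add_sub_cancel, Finset.sum_add_distrib]
      congr 1
      exact (Equiv.sum_comp (Equiv.addRight (1 : Fin (n + 1))) fun i => u k (z i).1).symm
    rw [hsum]
    exact Finset.sum_le_sum fun i _ => huv k ((z (i + 1)).1, (z i).2)
  · intro ϖ h1 h2
    have hϖ : IsProbabilityMeasure ϖ := ⟨by rw [← Measure.fst_univ, h1, measure_univ]⟩
    have hgapϖ : ∀ n, ∫ z, gap n z ∂ϖ =
        ∫ x, u n x ∂μ + ∫ y, v n y ∂ν - ∫ z, c z ∂ϖ := by
      intro n
      obtain ⟨hi, he⟩ := integral_fst_add_snd h1 h2 (u n) (v n)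
      rw [← he, ← integral_sub hi (integrable_continuousMap ϖ c)]
      rfl
    have hle : ∫ z, c z ∂ϖ ≤ ∫ z, c z ∂π := by
      rw [hπ]
      exact le_csInf (dualValues_nonempty μ ν c) fun r hr =>
        integral_le_of_mem_dualValues μ ν hr h1 h2
    refine ⟨hle, fun heq => ?_, fun hϖG => le_antisymm hle ?_⟩
    · have hfin : ∑' n, ∫⁻ z, ENNReal.ofReal (gap n z) ∂ϖ ≠ ∞ := by
        refine ne_top_of_le_ne_top (b := ∑' n : ℕ, ENNReal.ofReal ((1 / 2 : ℝ) ^ n)) ?_ ?_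
        · rw [← ENNReal.ofReal_tsum_of_nonneg (fun n => by positivity)
            summable_geometric_two]
          exact ENNReal.ofReal_ne_top
        · refine ENNReal.tsum_le_tsum fun n => ?_
          rw [← ofReal_integral_eq_lintegral_ofReal (integrable_continuousMap ϖ (gap n))
            (Eventually.of_forall (hgap0 n)), hgapϖ, heq, hπ]
          exact ENNReal.ofReal_le_ofReal (by linarith [hlt n])
      rw [← lintegral_tsum fun n =>
        ((gap n).continuous.measurable.ennreal_ofReal).aemeasurable] at hfin
      have hae := ae_lt_top' (AEMeasurable.tsum fun n =>
        ((gap n).continuous.measurable.ennreal_ofReal).aemeasurable) hfin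
      rw [← prob_compl_eq_zero_iff hG]
      refine measure_mono_null (fun z hz => ?_) (ae_iff.1 hae)
      intro hz'
      refine hz ?_
      have := ENNReal.tendsto_atTop_zero_of_tsum_ne_top hz'.ne
      have h3 := (ENNReal.tendsto_toReal ENNReal.zero_ne_top).comp this
      simp only [Function.comp_def, ENNReal.toReal_ofReal (hgap0 _ z),
        ENNReal.toReal_zero] at h3
      exact h3
    · have hae : ∀ᵐ z ∂ϖ, Tendsto (fun n => gap n z) atTop (𝓝 0) :=
        (prob_compl_eq_zero_iff hG).2 hϖG
      -- The potentials lie in [0, ‖c‖], so the gaps are at most 2‖c‖.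
      have hlim := tendsto_integral_of_dominated_convergence (F := fun n z => gap n z)
        (f := fun _ => 0) (bound := fun _ => 2 * ‖c‖)
        (fun n => (gap n).continuous.aestronglyMeasurable) (integrable_const _)
        (fun n => Eventually.of_forall fun z => by
          rw [Real.norm_of_nonneg (hgap0 n z), hgap]
          linarith [(hu n z.1).2, (hv n z.2).2, h0 z]) hae
      rw [integral_zero] at hlim
      have : ∫ z, c z ∂π - ∫ z, c z ∂ϖ ≤ 0 := by
        refine ge_of_tendsto' hlim fun n => ?_
        rw [hgapϖ, hπ]
        have := dualValue_le μ ν (huv n)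
        linarith
      linarith

end Kantorovich

end TimelikeCD

end

noncomputable section

namespace TimelikeCD.LorentzianPreLengthSpace

set_option linter.unusedSectionVars false

open Filter Topology

/-! ### Strong timelike dualizability. -/

section Dualizable

variable {M : Type*} [MetricSpace M] [SecondCountableTopology M] [MeasurableSpace M]
  [BorelSpace M]

lemma coe_sum_ereal {ι : Type*} (s : Finset ι) (f : ι → ℝ) :
    ((∑ i ∈ s, f i : ℝ) : EReal) = ∑ i ∈ s, (f i : EReal) :=
  map_sum (⟨⟨Real.toEReal, EReal.coe_zero⟩, EReal.coe_add⟩ : ℝ →+ EReal) f s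

lemma ae_mem_support_prod {μ ν : ProbabilityMeasure M} {ϖ : Measure (M × M)}
    (h : ϖ ∈ Couplings μ ν) :
    ∀ᵐ q ∂ϖ, q.1 ∈ (μ : Measure M).support ∧ q.2 ∈ (ν : Measure M).support := by
  have h1 : ∀ᵐ x ∂(μ : Measure M), x ∈ (μ : Measure M).support := Measure.support_mem_ae
  have h2 : ∀ᵐ x ∂(ν : Measure M), x ∈ (ν : Measure M).support := Measure.support_mem_ae
  refine Eventually.and ?_ ?_
  · rw [← h.1] at h1 ⊢
    exact ae_of_ae_map measurable_fst.aemeasurable h1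
  · rw [← h.2] at h2 ⊢
    exact ae_of_ae_map measurable_snd.aemeasurable h2

lemma isProbabilityMeasure_of_mem_couplings {μ ν : ProbabilityMeasure M} {ϖ : Measure (M × M)}
    (h : ϖ ∈ Couplings μ ν) : IsProbabilityMeasure ϖ :=
  ⟨by rw [← Measure.fst_univ, h.1, measure_univ]⟩

/-- A coupling concentrated on `A ×ˢ B` restricts to a coupling on the product of subtypes. -/
lemma map_comap_subtype_of_mem_couplings {μ ν : ProbabilityMeasure M} {A B : Set M} (hA : MeasurableSet A)
    (hB : MeasurableSet B) {ϖ : Measure (M × M)} (h : ϖ ∈ Couplings μ ν)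
    (hAB : ∀ᵐ q ∂ϖ, q.1 ∈ A ∧ q.2 ∈ B) :
    (ϖ.comap (Prod.map (Subtype.val : A → M) (Subtype.val : B → M))).map
        (Prod.map Subtype.val Subtype.val) = ϖ ∧
      (ϖ.comap (Prod.map (Subtype.val : A → M) (Subtype.val : B → M))).fst =
        (μ : Measure M).comap Subtype.val ∧
      (ϖ.comap (Prod.map (Subtype.val : A → M) (Subtype.val : B → M))).snd =
        (ν : Measure M).comap Subtype.val := by
  have he := (MeasurableEmbedding.subtype_coe hA).prodMap (MeasurableEmbedding.subtype_coe hB)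
  have hmap : (ϖ.comap (Prod.map (Subtype.val : A → M) (Subtype.val : B → M))).map
        (Prod.map Subtype.val Subtype.val) = ϖ := by
    rw [he.map_comap]
    refine Measure.restrict_eq_self_of_ae_mem ?_
    filter_upwards [hAB] with q hq
    exact ⟨(⟨q.1, hq.1⟩, ⟨q.2, hq.2⟩), rfl⟩
  refine ⟨hmap, ?_, ?_⟩
  · rw [← h.1]
    nth_rewrite 2 [← hmap]
    rw [Measure.fst, Measure.fst, Measure.map_map measurable_fst he.measurable, Prod.map_fst',
      ← Measure.map_map measurable_subtype_coe measurable_fst,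
      (MeasurableEmbedding.subtype_coe hA).comap_map]
  · rw [← h.2]
    nth_rewrite 2 [← hmap]
    rw [Measure.snd, Measure.snd, Measure.map_map measurable_snd he.measurable, Prod.map_snd',
      ← Measure.map_map measurable_subtype_coe measurable_snd,
      (MeasurableEmbedding.subtype_coe hB).comap_map]

variable {L : LorentzianPreLengthSpace M}

/-- Compactly supported measures with chronologically related supports are strongly timelike
dualizable if the time separation is finite and continuous. -/
theorem stronglyTimelikeDualizable_of_chron (hfin : ∀ x y, L.tau x y ≠ ∞)
    (hcont : Continuous (fun q : M × M => L.tau q.1 q.2)) {p : ℝ} (hp : 0 < p)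
    {μ ν : ProbabilityMeasure M} (hμ : IsCompact (μ : Measure M).support)
    (hν : IsCompact (ν : Measure M).support)
    (hchron : ∀ x ∈ (μ : Measure M).support, ∀ y ∈ (ν : Measure M).support, L.chron x y) :
    L.StronglyTimelikeDualizable p μ ν := by
  set A := (μ : Measure M).support with hAdef
  set B := (ν : Measure M).support with hBdef
  have hA : MeasurableSet A := hμ.isClosed.measurableSet
  have hB : MeasurableSet B := hν.isClosed.measurableSet
  have : CompactSpace A := isCompact_iff_compactSpace.1 hμ
  have : CompactSpace B := isCompact_iff_compactSpace.1 hν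
  -- The transport problem is moved to the compact supports, where the cost is real and continuous,
  -- and carried back along `e`.
  let e : A × B → M × M := Prod.map Subtype.val Subtype.val
  have he : MeasurableEmbedding e :=
    (MeasurableEmbedding.subtype_coe hA).prodMap (MeasurableEmbedding.subtype_coe hB)
  have hμA : (μ : Measure M).restrict A = μ :=
    Measure.restrict_eq_self_of_ae_mem Measure.support_mem_ae
  have hνB : (ν : Measure M).restrict B = ν :=
    Measure.restrict_eq_self_of_ae_mem Measure.support_mem_ae
  let μ' : Measure A := (μ : Measure M).comap Subtype.val
  let ν' : Measure B := (ν : Measure M).comap Subtype.val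
  have hμ' : μ'.map Subtype.val = (μ : Measure M) := by
    rw [map_comap_subtype_coe hA, hμA]
  have hν' : ν'.map Subtype.val = (ν : Measure M) := by
    rw [map_comap_subtype_coe hB, hνB]
  have : IsProbabilityMeasure μ' := ⟨by
    rw [← preimage_univ (f := Subtype.val), ← Measure.map_apply measurable_subtype_coe
      MeasurableSet.univ, hμ', measure_univ]⟩
  have : IsProbabilityMeasure ν' := ⟨by
    rw [← preimage_univ (f := Subtype.val), ← Measure.map_apply measurable_subtype_coe
      MeasurableSet.univ, hν', measure_univ]⟩
  let c : C(A × B, ℝ) := ⟨fun z => (L.tau z.1 z.2).toReal ^ p, by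
    refine Continuous.rpow_const ?_ fun _ => Or.inr hp.le
    refine ENNReal.continuousOn_toReal.comp_continuous
      (hcont.comp (by fun_prop : Continuous e)) fun z => hfin _ _⟩
  have hc0 : ∀ z, 0 ≤ c z := fun z => Real.rpow_nonneg ENNReal.toReal_nonneg p
  have hcτ : ∀ z : A × B, L.tau z.1 z.2 ^ p = ENNReal.ofReal (c z) := by
    intro z
    change _ = ENNReal.ofReal ((L.tau z.1 z.2).toReal ^ p)
    rw [ENNReal.toReal_rpow, ENNReal.ofReal_toReal
      (ENNReal.rpow_ne_top_of_nonneg hp.le (hfin _ _))]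
  have hcost : ∀ z : A × B, L.costPow p z.1 z.2 = ((c z : ℝ) : EReal) := by
    intro z
    rw [costPow, if_pos (L.causal_of_chron _ _ (hchron _ z.1.2 _ z.2.2)), hcτ,
      EReal.coe_ennreal_ofReal, max_eq_left (hc0 z)]
  obtain ⟨π', G, hπ1, hπ2, hG, hcyc, hopt⟩ := exists_optimal_coupling_and_set μ' ν' c hc0
  have hnorm : ∀ ϖ : Measure (A × B), IsFiniteMeasure ϖ →
      L.tauNorm p (ϖ.map e) = ENNReal.ofReal (∫ z, c z ∂ϖ) ^ (1 / p) := by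
    intro ϖ _
    rw [tauNorm, he.lintegral_map,
      ofReal_integral_eq_lintegral_ofReal (integrable_continuousMap ϖ c)
        (Eventually.of_forall hc0)]
    congr 1
    exact lintegral_congr fun z => hcτ z
  have hπc : π'.map e ∈ Couplings μ ν := by
    constructor
    · rw [Measure.fst, Measure.map_map measurable_fst he.measurable, Prod.map_fst',
        ← Measure.map_map measurable_subtype_coe measurable_fst, ← hμ', ← hπ1]
      rfl
    · rw [Measure.snd, Measure.map_map measurable_snd he.measurable, Prod.map_snd',
        ← Measure.map_map measurable_subtype_coe measurable_snd, ← hν', ← hπ2]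
      rfl
  -- All couplings are chronological here, so the causality constraint is void.
  have hchronae : ∀ ϖ ∈ Couplings μ ν, ∀ᵐ q ∂ϖ, L.chron q.1 q.2 := by
    intro ϖ hϖ
    filter_upwards [ae_mem_support_prod hϖ] with q hq
    exact hchron _ hq.1 _ hq.2
  have hcausal : ∀ ϖ ∈ Couplings μ ν, ϖ ∈ L.CausalCouplings μ ν := fun ϖ hϖ =>
    ⟨hϖ, (hchronae ϖ hϖ).mono fun q hq => L.causal_of_chron _ _ hq⟩
  have hrep : ∀ ϖ ∈ Couplings μ ν, ∃ ϖ' : Measure (A × B), IsProbabilityMeasure ϖ' ∧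
      ϖ'.map e = ϖ ∧ ϖ'.fst = μ' ∧ ϖ'.snd = ν' := by
    intro ϖ hϖ
    obtain ⟨h1, h2, h3⟩ := map_comap_subtype_of_mem_couplings hA hB hϖ (ae_mem_support_prod hϖ)
    exact ⟨ϖ.comap e, ⟨by rw [← Measure.fst_univ, h2]; exact measure_univ⟩, h1, h2, h3⟩
  have hπprob : IsProbabilityMeasure π' := ⟨by rw [← Measure.fst_univ, hπ1, measure_univ]⟩
  have hle : ∀ ϖ ∈ Couplings μ ν, L.tauNorm p ϖ ≤ L.tauNorm p (π'.map e) := by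
    intro ϖ hϖ
    obtain ⟨ϖ', hprob, rfl, h1, h2⟩ := hrep ϖ hϖ
    rw [hnorm _ inferInstance, hnorm _ inferInstance]
    exact ENNReal.rpow_le_rpow (ENNReal.ofReal_le_ofReal (hopt ϖ' h1 h2).1) (by positivity)
  have hsup : L.lorentzWasserstein p μ ν = ((L.tauNorm p (π'.map e) : ℝ≥0∞) : EReal) := by
    refine le_antisymm (iSup₂_le fun ϖ hϖ => ?_) (le_iSup₂_of_le _ (hcausal _ hπc) le_rfl)
    exact EReal.coe_ennreal_le_coe_ennreal_iff.2 (hle ϖ hϖ.1)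
  -- Dualizability only asks for an integrable upper bound of the cost, not optimal potentials;
  -- constants suffice.
  refine ⟨⟨π'.map e, ⟨hπc, hchronae _ hπc⟩, ⟨hcausal _ hπc, hsup⟩, fun _ => ‖c‖, fun _ => 0,
    measurable_const, measurable_const, integrable_const _, fun x hx y hy => ?_⟩, e '' G,
    he.measurableSet_image.2 hG, ?_, ?_, ?_⟩
  · rw [hcost (⟨x, hx⟩, ⟨y, hy⟩), add_zero]
    exact EReal.coe_le_coe_iff.2 ((le_abs_self _).trans (c.norm_coe_le_norm _))
  · rintro _ ⟨z, -, rfl⟩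
    exact ⟨hchron _ z.1.2 _ z.2.2, z.1.2, z.2.2⟩
  · intro n z hz
    choose w hw hwz using hz
    have h1 : ∀ i j, L.costPow p (z i).1 (z j).2 = ((c ((w i).1, (w j).2) : ℝ) : EReal) := by
      intro i j
      rw [← hwz i, ← hwz j]
      exact hcost ((w i).1, (w j).2)
    simp only [h1]
    rw [← coe_sum_ereal, ← coe_sum_ereal]
    exact EReal.coe_le_coe_iff.2 (hcyc n w hw)
  · intro ϖ hϖ
    obtain ⟨ϖ', hprob, rfl, h1, h2⟩ := hrep ϖ hϖ.1
    rw [he.map_apply, preimage_image_eq _ he.injective, ← (hopt ϖ' h1 h2).2, IsOptimal, hsup,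
      EReal.coe_ennreal_eq_coe_ennreal_iff, hnorm _ inferInstance, hnorm _ inferInstance]
    have hinj : ∀ a b : ℝ, 0 ≤ a → 0 ≤ b →
        (ENNReal.ofReal a ^ (1 / p) = ENNReal.ofReal b ^ (1 / p) ↔ a = b) := by
      intro a b ha hb
      rw [(ENNReal.rpow_left_injective (one_div_ne_zero hp.ne')).eq_iff,
        ENNReal.ofReal_eq_ofReal_iff ha hb]
    rw [hinj _ _ (integral_nonneg hc0) (integral_nonneg hc0)]
    exact ⟨fun h => h.2.symm, fun h => ⟨hϖ, h.symm⟩⟩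

end Dualizable

end TimelikeCD.LorentzianPreLengthSpace

end

/-! ### Infinite distortion, finite entropy and the diameter bound. -/

noncomputable section

namespace TimelikeCD

open Filter Topology

/-- For N > 1 the bound on `θ` gives K θ²/(N-1) ≥ π², the infinite branch of `sigmaCoeff`; for N = 1
it only says θ > 0, which already selects the infinite branch. -/
lemma tauCoeff_eq_top {K N t θ : ℝ} (hK : 0 < K) (hN : 1 ≤ N) (ht : 0 < t)
    (hθ : Real.pi * √((N - 1) / K) < θ) : tauCoeff K N t θ = ∞ := by
  have hD : 0 ≤ Real.pi * √((N - 1) / K) := by positivity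
  have hθ0 : 0 < θ := hD.trans_lt hθ
  have h1 : ENNReal.ofReal t ^ (1 / N) ≠ 0 := by
    have : ENNReal.ofReal t ≠ 0 := by simpa using ht
    simp [ENNReal.rpow_eq_zero_iff, this]
  rw [tauCoeff]
  split_ifs with hN1 h2
  · exact ENNReal.mul_top h1
  · exact absurd (by positivity) h2
  · have hN' : 0 < N - 1 := sub_pos.2 (lt_of_le_of_ne hN (Ne.symm hN1))
    have h3 : Real.pi ^ 2 ≤ K / (N - 1) * θ ^ 2 := by
      have h4 := pow_le_pow_left₀ hD hθ.le 2
      rw [mul_pow, Real.sq_sqrt (by positivity)] at h4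
      calc Real.pi ^ 2 = K / (N - 1) * (Real.pi ^ 2 * ((N - 1) / K)) := by field_simp
        _ ≤ _ := by gcongr
    have h5 : 0 < 1 - 1 / N := by
      rw [sub_pos, div_lt_one (by linarith)]
      linarith
    rw [sigmaCoeff, if_pos h3, ENNReal.top_rpow_of_pos h5]
    exact ENNReal.mul_top h1

lemma rpow_le_one_add (x : ℝ≥0∞) {s : ℝ} (h0 : 0 ≤ s) (h1 : s ≤ 1) : x ^ s ≤ 1 + x := by
  rcases le_total x 1 with h | h
  · exact (ENNReal.rpow_le_one h h0).trans le_self_add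
  · calc x ^ s ≤ x ^ (1 : ℝ) := ENNReal.rpow_le_rpow_of_exponent_le h h1
      _ = x := ENNReal.rpow_one x
      _ ≤ 1 + x := le_add_self

/-- The Rényi entropy of a measure concentrated on a set of finite volume is not `-∞`. -/
lemma renyiEntropy_ne_bot {M : Type*} [MeasurableSpace M] {N : ℝ} (hN : 1 ≤ N)
    (m μ : Measure M) [IsFiniteMeasure μ] {J : Set M} (hJ : MeasurableSet J) (hmJ : m J ≠ ∞)
    (hμJ : μ Jᶜ = 0) : renyiEntropy N m μ ≠ ⊥ := by
  have hρ : ∀ᵐ x ∂m, x ∉ J → μ.rnDeriv m x = 0 := by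
    have h1 : ∫⁻ x in Jᶜ, μ.rnDeriv m x ∂m = 0 :=
      le_antisymm ((Measure.setLIntegral_rnDeriv_le _).trans hμJ.le) zero_le
    rw [lintegral_eq_zero_iff (Measure.measurable_rnDeriv μ m)] at h1
    exact (ae_restrict_iff' hJ.compl).1 h1
  have hexp0 : 0 ≤ 1 - 1 / N := by
    rw [sub_nonneg, div_le_one (by linarith)]; exact hN
  have hexp1 : 1 - 1 / N ≤ 1 := by
    have : 0 ≤ 1 / N := by positivity
    linarith
  have hfin : ∫⁻ x in {x | 0 < μ.rnDeriv m x}, μ.rnDeriv m x ^ (1 - 1 / N) ∂m ≠ ∞ := by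
    -- With s = 1 - 1/N in [0,1], ρ^s ≤ 1 + ρ, and almost everywhere ρ > 0 forces the point into
    -- `J`.
    refine ne_top_of_le_ne_top (b := m J + μ univ)
      (ENNReal.add_ne_top.2 ⟨hmJ, measure_ne_top _ _⟩) ?_
    calc _ ≤ ∫⁻ x in {x | 0 < μ.rnDeriv m x}, (J.indicator 1 x + μ.rnDeriv m x) ∂m := by
          refine setLIntegral_mono_ae' (measurableSet_lt measurable_const
            (Measure.measurable_rnDeriv μ m)) ?_
          filter_upwards [hρ] with x hx hpos
          have hxJ : x ∈ J := by
            by_contra h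
            exact (hx h ▸ hpos : (0 : ℝ≥0∞) < 0).false
          rw [indicator_of_mem hxJ]
          exact rpow_le_one_add _ hexp0 hexp1
      _ ≤ ∫⁻ x, (J.indicator 1 x + μ.rnDeriv m x) ∂m := setLIntegral_le_lintegral _ _
      _ = m J + ∫⁻ x, μ.rnDeriv m x ∂m := by
          rw [lintegral_add_right _ (Measure.measurable_rnDeriv μ m), lintegral_indicator_one hJ]
      _ ≤ m J + μ univ := by gcongr; exact Measure.lintegral_rnDeriv_le
  rw [renyiEntropy, Ne, EReal.neg_eq_bot_iff, EReal.coe_ennreal_eq_top_iff]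
  exact hfin

namespace LorentzianPreLengthSpace

variable {M : Type*} [MetricSpace M] {L : LorentzianPreLengthSpace M}

/-- The points of the proper-time reparametrization of a timelike geodesic lie on it. -/
lemma exists_reparam_eq (hfin : ∀ x y, L.tau x y ≠ ∞)
    (hcont : Continuous (fun q : M × M => L.tau q.1 q.2)) (hself : ∀ x, L.tau x x = 0)
    {η : C(I, M)} (hη : η ∈ L.TGeo) (t : I) : ∃ s, L.reparam η t = η s := by
  rw [reparam]
  split_ifs with h
  · have hpos : (L.tau (η 0) (η 1)).toReal ≠ 0 :=
      (ENNReal.toReal_pos ((L.tau_pos_iff _ _).2 (hη.2.2 0 1 zero_lt_one)).ne'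
        (hfin _ _)).ne'
    have hψ : Continuous fun s : I =>
        (L.tau (η 0) (η s)).toReal / (L.tau (η 0) (η 1)).toReal := by
      refine Continuous.div_const ?_ _
      exact ENNReal.continuousOn_toReal.comp_continuous
        (hcont.comp (by fun_prop : Continuous fun s : I => (η 0, η s))) fun s => hfin _ _
    -- Intermediate values suffice: ψ runs continuously from 0 to 1, and its injectivity is not
    -- needed.
    obtain ⟨s, hs⟩ := mem_range_of_exists_le_of_exists_ge (c := (t : ℝ)) hψ
      ⟨0, by simpa [hself] using t.2.1⟩ ⟨1, by simpa [div_self hpos] using t.2.2⟩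
    exact ⟨s, h.choose_spec s t hs.symm⟩
  · exact ⟨t, rfl⟩

variable [MeasurableSpace M] [BorelSpace M] [SecondCountableTopology M]

/-- The intermediate measures of a timelike geodesic are concentrated on a causal diamond that
contains the supports of the endpoints in its chronological interior. -/
lemma measure_compl_causalDiamond_eq_zero (hfin : ∀ x y, L.tau x y ≠ ∞)
    (hcont : Continuous (fun q : M × M => L.tau q.1 q.2)) (hself : ∀ x, L.tau x x = 0)
    {p : ℝ} {μ : I → ProbabilityMeasure M} (hμ : L.IsTimelikeProperTimeGeodesic p μ) {a b : M}
    (hJ : MeasurableSet (L.causalDiamond a b))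
    (ha : ∀ x ∈ (μ 0 : Measure M).support, L.causal a x)
    (hb : ∀ x ∈ (μ 1 : Measure M).support, L.causal x b) (t : I) :
    (μ t : Measure M) (L.causalDiamond a b)ᶜ = 0 := by
  obtain ⟨-, Λ, ⟨α, ⟨-, hgeo, hopt⟩, rfl⟩, hμt⟩ := hμ
  -- Otherwise the push-forward would be zero by convention, although its evaluation at t is a
  -- probability measure.
  have hmeas : AEMeasurable L.reparam α := by
    by_contra h
    have h1 := hμt t
    simp only [Measure.map_of_not_aemeasurable h, Measure.map_zero] at h1
    exact IsProbabilityMeasure.ne_zero _ h1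
  have heval : Measurable fun γ : C(I, M) => γ t := (continuous_eval_const t).measurable
  have hends : ∀ᵐ γ ∂α, γ 0 ∈ (μ 0 : Measure M).support ∧ γ 1 ∈ (μ 1 : Measure M).support :=
    ae_of_ae_map ((continuous_eval_const 0).measurable.prodMk
      (continuous_eval_const 1).measurable).aemeasurable (ae_mem_support_prod hopt.1.1)
  have hae : ∀ᵐ γ ∂α, L.reparam γ t ∈ L.causalDiamond a b := by
    filter_upwards [hgeo, hends] with γ hγ he
    obtain ⟨s, hs⟩ := exists_reparam_eq hfin hcont hself hγ t
    rw [hs]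
    exact ⟨L.causal_trans _ _ _ (ha _ he.1) (causal_of_geo hγ.1 zero_le),
      L.causal_trans _ _ _ (causal_of_geo hγ.1 unitInterval.le_one') (hb _ he.2)⟩
  rw [hμt t, Measure.map_apply heval hJ.compl,
    Measure.map_apply_of_aemeasurable hmeas (heval hJ.compl)]
  exact hae

end LorentzianPreLengthSpace

lemma exists_mem_pcAC_support_subset {M : Type*} [MetricSpace M] [MeasurableSpace M]
    [BorelSpace M] (m : Measure M) [IsFiniteMeasureOnCompacts m] {A : Set M} (hA : IsCompact A)
    (hmA : m A ≠ 0) : ∃ μ ∈ PcAC m, (μ : Measure M).support ⊆ A := by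
  have hprob := ProbabilityTheory.cond_isProbabilityMeasure_of_finite hmA hA.measure_ne_top
  have hsub : (ProbabilityTheory.cond m A).support ⊆ A :=
    Measure.support_subset_of_isClosed hA.isClosed
      (ProbabilityTheory.ae_cond_mem hA.isClosed.measurableSet)
  exact ⟨⟨ProbabilityTheory.cond m A, hprob⟩,
    ⟨hA.of_isClosed_subset Measure.isClosed_support hsub,
      ProbabilityTheory.cond_absolutelyContinuous⟩, hsub⟩

end TimelikeCD

end

open TimelikeCD TimelikeCD.LorentzianPreLengthSpace Filter Topology in
theorem corollary3p10 {M : Type*} [MetricSpace M] [ProperSpace M]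
    [MeasurableSpace M] [BorelSpace M]
    (m : MeasureTheory.Measure M) [m.Regular] [m.IsOpenPosMeasure]
    (L : TimelikeCD.LorentzianPreLengthSpace M)
    (hclosed : L.LocallyCausallyClosed)
    (hgh : L.GloballyHyperbolic)
    (hgeo : L.IsGeodesicSpace)
    (p K N : ℝ) (hp₀ : 0 < p) (hp₁ : p < 1) (hK : 0 < K) (hN : 1 ≤ N)
    (hTCD : TimelikeCD.WTCD L m p K N) :
    (⨆ q : M × M, L.tau q.1 q.2) ≤ ENNReal.ofReal (Real.pi * √((N - 1) / K)) := by
  by_contra hcon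
  obtain ⟨⟨x, y⟩, hxy⟩ := lt_iSup_iff.1 (not_le.1 hcon)
  have hfin := tau_ne_top hclosed hgeo
  have hcont := continuous_tau hclosed hgh hgeo
  obtain ⟨a, hax⟩ := (hgeo.1.exists_chron x).1
  obtain ⟨b, hyb⟩ := (hgeo.1.exists_chron y).2
  have hnear : ∀ᶠ q : M × M in 𝓝 (x, y),
      ENNReal.ofReal (Real.pi * √((N - 1) / K)) < L.tau q.1 q.2 ∧
        L.chron a q.1 ∧ L.chron q.2 b := by
    refine Filter.Eventually.and (hcont.tendsto (x, y) |>.eventually (lt_mem_nhds hxy)) ?_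
    refine Filter.Eventually.and ?_ ?_
    · exact (isOpen_setOf_chron (L := L)).preimage
        (continuous_const.prodMk continuous_fst) |>.mem_nhds hax
    · exact (isOpen_setOf_chron (L := L)).preimage
        (continuous_snd.prodMk continuous_const) |>.mem_nhds hyb
  obtain ⟨r, hr, hball⟩ := Metric.nhds_basis_closedBall.mem_iff.1 hnear
  rw [← closedBall_prod_same] at hball
  have hpos : ∀ z : M, m (Metric.closedBall z r) ≠ 0 := fun z =>
    (Metric.measure_closedBall_pos m z hr).ne'
  obtain ⟨μ₀, hμ₀, hs₀⟩ := exists_mem_pcAC_support_subset m (isCompact_closedBall x r) (hpos x)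
  obtain ⟨μ₁, hμ₁, hs₁⟩ := exists_mem_pcAC_support_subset m (isCompact_closedBall y r) (hpos y)
  have hprod : ∀ z ∈ (μ₀ : MeasureTheory.Measure M).support,
      ∀ w ∈ (μ₁ : MeasureTheory.Measure M).support,
        ENNReal.ofReal (Real.pi * √((N - 1) / K)) < L.tau z w ∧ L.chron a z ∧ L.chron w b :=
    fun z hz w hw => hball (mk_mem_prod (hs₀ hz) (hs₁ hw))
  -- Points of both supports are needed to read one-sided relations off `hprod`.
  obtain ⟨z₀, hz₀⟩ := MeasureTheory.Measure.nonempty_support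
    (MeasureTheory.IsProbabilityMeasure.ne_zero (μ₀ : MeasureTheory.Measure M))
  obtain ⟨z₁, hz₁⟩ := MeasureTheory.Measure.nonempty_support
    (MeasureTheory.IsProbabilityMeasure.ne_zero (μ₁ : MeasureTheory.Measure M))
  have hdual : L.StronglyTimelikeDualizable p μ₀ μ₁ :=
    stronglyTimelikeDualizable_of_chron hfin hcont hp₀ hμ₀.1 hμ₁.1 fun z hz w hw =>
      (L.tau_pos_iff _ _).1 (zero_le.trans_lt (hprod z hz w hw).1)
  obtain ⟨μ, hμ, rfl, rfl, π, hπ, hent⟩ := hTCD μ₀ hμ₀ μ₁ hμ₁ hdual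
  have hJ : IsCompact (L.causalDiamond a b) := hgh.2 a b
  have hnull := measure_compl_causalDiamond_eq_zero hfin hcont hgeo.1.tau_self hμ
    hJ.isClosed.measurableSet
    (fun z hz => L.causal_of_chron _ _ (hprod z hz z₁ hz₁).2.1)
    (fun w hw => L.causal_of_chron _ _ (hprod z₀ hz₀ w hw).2.2)
  -- Any t < 1 would do: only 1 - t > 0 matters.
  let t : unitInterval := ⟨1 / 2, by norm_num, by norm_num⟩
  have ht : (0 : ℝ) < 1 - t := by norm_num [t]
  refine renyiEntropy_ne_bot hN m (μ t) hJ.isClosed.measurableSet hJ.measure_ne_top (hnull t)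
    (le_bot_iff.1 ((hent t N le_rfl).trans ?_))
  have hπc := hπ.1.1
  have := isProbabilityMeasure_of_mem_couplings hπc
  have htop : ∫⁻ q, tauCoeff K N (1 - t) (L.tau q.1 q.2).toReal *
      (μ 0 : MeasureTheory.Measure M).rnDeriv m q.1 ^ (-1 / N) ∂π = ⊤ := by
    have hρ : ∀ᵐ q ∂π, (μ 0 : MeasureTheory.Measure M).rnDeriv m q.1 < ⊤ := by
      have h1 := hμ₀.2.ae_le (MeasureTheory.Measure.rnDeriv_lt_top
        (μ 0 : MeasureTheory.Measure M) m)
      rw [← hπc.1] at h1 ⊢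
      exact MeasureTheory.ae_of_ae_map measurable_fst.aemeasurable h1
    have hae : (fun q : M × M => tauCoeff K N (1 - t) (L.tau q.1 q.2).toReal *
        (μ 0 : MeasureTheory.Measure M).rnDeriv m q.1 ^ (-1 / N)) =ᵐ[π] fun _ => ⊤ := by
      filter_upwards [hρ, ae_mem_support_prod hπc] with q hq hsupp
      have h2 := (ENNReal.ofReal_lt_iff_lt_toReal (by positivity) (hfin _ _)).1
        (hprod _ hsupp.1 _ hsupp.2).1
      rw [tauCoeff_eq_top hK hN ht h2]
      -- The density is finite almost everywhere, so its negative power is nonzero and does not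
      -- cancel the infinite coefficient.
      refine ENNReal.top_mul fun h3 => ?_
      rcases ENNReal.rpow_eq_zero_iff.1 h3 with ⟨-, h4⟩ | ⟨h4, -⟩
      · have : -1 / N ≤ 0 := div_nonpos_of_nonpos_of_nonneg (by norm_num) (by linarith)
        linarith
      · exact hq.ne h4
    rw [MeasureTheory.lintegral_congr_ae hae, MeasureTheory.lintegral_const,
      MeasureTheory.measure_univ, mul_one]
  -- The first term alone is -∞, and in `EReal` adding anything to `⊥` gives `⊥`.
  rw [htop, EReal.coe_ennreal_top, EReal.neg_top, sub_eq_add_neg, EReal.bot_add]
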